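/- **Setting.** Let $B$ be a unital complex algebra. A $B$-$B$-bimodule with specified $B$-projection is a direct sum of $B$-$B$-bimodules $\mathcal X=B\oplus\mathring{\mathcal X}$ with $p(b\oplus\eta)=b$; $\mathcal L(\mathcal X)$ is the algebra of $\mathbb C$-linear maps on $\mathcal X$, with expectation $E_{\mathcal L(\mathcal X)}(T)=p(T(1_B\oplus 0))$; $L_b,R_b$ are left and right multiplication by $b$; $\mathcal L_\ell(\mathcal X)$ (resp. $\mathcal L_r(\mathcal X)$) is the commutant of all $R_b$ (resp. of all $L_b$). A $B$-$B$-non-commutative probability space $(\mathcal A,E,\varepsilon)$ is a unital complex algebra $\mathcal A$ with a unital homomorphism $\varepsilon:B\otimes B^{\mathrm{op}}\to\mathcal A$, injective on $B\otimes 1$ and on $1\otimes B^{\mathrm{op}}$, and a linear map $E:\mathcal A\to B$ with $E(\varepsilon(b_1\otimes b_2)T)=b_1E(T)b_2$ and $E(T\varepsilon(b\otimes 1))=E(T\varepsilon(1\otimes b))$; put $L_b=\varepsilon(b\otimes1)$, $R_b=\varepsilon(1\otimes b)$, and let $\mathcal A_\ell,\mathcal A_r$ be the commutants of all $R_b$,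 resp. of all $L_b$. A triple of $B$-faces is $(A^\ell,A^r,A^b)$ with $A^\ell,A^r$ unital subalgebras and $A^b$ a (not necessarily unital) subalgebra of $\mathcal A$, such that $L_B\subseteq A^\ell\subseteq\mathcal A_\ell$, $R_B\subseteq A^r\subseteq\mathcal A_r$ and $L_BA^bL_B\subseteq A^b\subseteq\mathcal A_\ell$. The joint distribution of a triple, or of a family of triples, is the collection of moments $E(Z_1\cdots Z_n)$ of words of elements of its algebras. Two joint distributions of families with corresponding elements are equal if the moments of corresponding words are equal. A representation of a triple $(A^\ell,A^r,A^b)$ on $\mathcal X$ consists of unital homomorphisms $\ell:A^\ell\to\mathcal L_\ell(\mathcal X)$ and $r:A^r\to\mathcal L_r(\mathcal X)$ with $\ell(L_b)=L_b$ and $r(R_b)=R_b$ for all $b\in B$, and a not necessarily unital homomorphism $m:A^b\to\mathcal L(\mathcal X)$. Given a family of representations $(\ell_k,r_k,m_k)$ of triples $(A^\ell_k,A^r_k,A^b_k)$ on $\mathcal X_k$, $k\in K$, let $\mathcal X=B\oplus\bigoplus_{n\ge1}\bigoplus_{k_1\ne k_2\ne\cdots\ne k_n}\mathring{\mathcal X}_{k_1}\otimes_B\cdots\otimes_B\mathring{\mathcal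 X}_{k_n}$ be the reduced free product, $\lambda_k,\rho_k$ the left and right regular representations on $\mathcal X$, and $P_k$ the projection of $\mathcal X$ onto $\mathcal X_k=B\oplus\mathring{\mathcal X}_k$; $P_k\lambda_k(T)P_k$ is the operator acting as $T$ on $\mathcal X_k$ and as $0$ on the other summands. A family $\Gamma=\{(A^\ell_k,A^r_k,A^b_k)\}_{k\in K}$ of triples of $B$-faces in $\mathcal A$ is free-free-Boolean independent over $B$ *via* these representations if its joint distribution $\mu_\Gamma$ equals the joint distribution of $$\{(\lambda_k(\ell_k(A^\ell_k)),\ \rho_k(r_k(A^r_k)),\ P_k\lambda_k(m_k(A^b_k))P_k)\}_{k\in K}$$ in $(\mathcal L(\mathcal X),E_{\mathcal L(\mathcal X)})$; it is free-free-Boolean independent over $B$ if it is so via some family of representations. **Proposition.** Let $\Gamma=\{(A^\ell_k,A^r_k,A^b_k)\}_{k\in K}$ be a family of triples of $B$-faces in a $B$-$B$-non-commutative probability space $(\mathcal A,E,\varepsilon)$. For each $k\in K$ let $(\ell'_k,r'_k,m'_k)$ be a representation of the $k$-th triple on a $B$-$B$-bimodule with specified projection $\mathcal X'_k$, such that the joint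 distribution of $(A^\ell_k,A^r_k,A^b_k)$ equals that of $(\ell'_k(A^\ell_k),r'_k(A^r_k),m'_k(A^b_k))$ in $\mathcal L(\mathcal X'_k)$. Then: 1. $\Gamma$ is free-free-Boolean independent over $B$ if and only if it is so via the given representations $(\ell'_k,r'_k,m'_k)_{k\in K}$. 2. In this case $\mu_\Gamma$ equals the joint distribution of the re-represented family $\{(\lambda_k(\ell'_k(A^\ell_k)),\rho_k(r'_k(A^r_k)),P_k\lambda_k(m'_k(A^b_k))P_k)\}_{k\in K}$ on the reduced free product of the $\mathcal X'_k$. 3. Let, moreover, $\Gamma'$ be a family, indexed by $K$, of triples of $B$-faces in a further $B$-$B$-non-commutative probability space, whose $k$-th triple is the image of the $k$-th triple of $\Gamma$ under homomorphisms of its three algebras (unital on $A^\ell_k$ and $A^r_k$, and carrying $L_b\in A_k^\ell$ to $L_b$ and $R_b\in A_k^r$ to $R_b$), with the same joint distribution for each single $k$. If $\Gamma$ and $\Gamma'$ are both free-free-Boolean independent over $B$, then their joint distributions are equal. If their joint distributions are equal, then $\Gamma$ is free-free-Boolean independent over $B$ if and only if $\Gamma'$ is. -/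

import Mathlib

open scoped TensorProduct DirectSum
open MulOpposite

universe u v

noncomputable section

namespace FFB

/-! ## Bimodules with specified projection -/

/-- A `B`-`B`-bimodule (for a unital complex algebra `B`): commuting left and right actions of `B`,
the right action being written as an action of `Bᵐᵒᵖ`, both inducing the same action of `ℂ`. -/
structure Bimod (B : Type u) [Ring B] [Algebra ℂ B] where
  carrier : Type u
  [addCommGroup : AddCommGroup carrier]
  [moduleComplex : Module ℂ carrier]
  [moduleLeft : Module B carrier]
  [moduleRight : Module Bᵐᵒᵖ carrier]
  [commActions : SMulCommClass B Bᵐᵒᵖ carrier]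
  [towerLeft : IsScalarTower ℂ B carrier]
  [towerRight : IsScalarTower ℂ Bᵐᵒᵖ carrier]

attribute [instance] Bimod.addCommGroup Bimod.moduleComplex Bimod.moduleLeft Bimod.moduleRight
  Bimod.commActions Bimod.towerLeft Bimod.towerRight

section Basic

variable {B : Type u} [Ring B] [Algebra ℂ B]

/-- The bimodule with specified projection `𝒳 = B ⊕ M`; here `M` is the complement `𝒳°`, the
projection `p : 𝒳 → B` is the first coordinate, and both actions of `B` are componentwise. -/
abbrev Bimod.Total (M : Bimod B) : Type u := B × M.carrier

/-- The algebra `ℒ(𝒳)` of all `ℂ`-linear maps on `𝒳 = B ⊕ M`. -/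
abbrev Bimod.Op (M : Bimod B) : Type u := Module.End ℂ M.Total

/-- The expectation `T ↦ p (T (1_B ⊕ 0))` on the linear operators of a direct sum `B ⊕ N`. -/
def vacuumExp {N : Type*} [AddCommGroup N] [Module ℂ N] (T : Module.End ℂ (B × N)) : B :=
  (T (1, 0)).1

theorem left_smul_complex (M : Bimod B) (b : B) (c : ℂ) (x : M.carrier) :
    b • c • x = c • b • x := by
  rw [← one_smul B x, ← smul_assoc c (1 : B) x, smul_smul, smul_smul, ← smul_assoc]
  simp

theorem right_smul_complex (M : Bimod B) (b : Bᵐᵒᵖ) (c : ℂ) (x : M.carrier) :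
    b • c • x = c • b • x := by
  rw [← one_smul Bᵐᵒᵖ x, ← smul_assoc c (1 : Bᵐᵒᵖ) x, smul_smul, smul_smul, ← smul_assoc]
  simp

/-- `L_b ∈ ℒ(𝒳)`, left multiplication by `b`. -/
def Bimod.L (M : Bimod B) (b : B) : M.Op where
  toFun x := b • x
  map_add' := smul_add b
  map_smul' c x := by
    ext
    · simp
    · simp [left_smul_complex]

/-- `R_b ∈ ℒ(𝒳)`, right multiplication by `b`. -/
def Bimod.R (M : Bimod B) (b : B) : M.Op where
  toFun x := op b • x
  map_add' := smul_add (op b)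
  map_smul' c x := by
    ext
    · simp
    · simp [right_smul_complex]

/-- The left algebra `ℒ_ℓ(𝒳)`: operators commuting with all right multiplications `R_b`. -/
def Bimod.leftAlg (M : Bimod B) : Subalgebra ℂ M.Op :=
  Subalgebra.centralizer ℂ (Set.range M.R)

/-- The right algebra `ℒ_r(𝒳)`: operators commuting with all left multiplications `L_b`. -/
def Bimod.rightAlg (M : Bimod B) : Subalgebra ℂ M.Op :=
  Subalgebra.centralizer ℂ (Set.range M.L)

theorem leftAlg_apply {M : Bimod B} (a : M.leftAlg) (b : B) (x : M.Total) :
    (a : M.Op) (op b • x) = op b • (a : M.Op) x :=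
  (LinearMap.congr_fun ((Subalgebra.mem_centralizer_iff ℂ).1 a.2 (M.R b) ⟨b, rfl⟩) x).symm

theorem rightAlg_apply {M : Bimod B} (a : M.rightAlg) (b : B) (x : M.Total) :
    (a : M.Op) (b • x) = b • (a : M.Op) x :=
  (LinearMap.congr_fun ((Subalgebra.mem_centralizer_iff ℂ).1 a.2 (M.L b) ⟨b, rfl⟩) x).symm

theorem L_mem_leftAlg (M : Bimod B) (b : B) : M.L b ∈ M.leftAlg := by
  rw [Bimod.leftAlg, Subalgebra.mem_centralizer_iff]
  rintro _ ⟨c, rfl⟩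
  ext x
  all_goals simp [Bimod.L, Bimod.R, mul_assoc, smul_comm]

theorem R_mem_rightAlg (M : Bimod B) (b : B) : M.R b ∈ M.rightAlg := by
  rw [Bimod.rightAlg, Subalgebra.mem_centralizer_iff]
  rintro _ ⟨c, rfl⟩
  ext x
  all_goals simp [Bimod.L, Bimod.R, mul_assoc, smul_comm]

end Basic

/-! ## The reduced free product with amalgamation over `B` -/

section FreeProduct

variable {B : Type u} [Ring B] [Algebra ℂ B] {K : Type v} (X : K → Bimod B)

/-- An element of one of the bimodules `𝒳°_k`, together with its index `k`. -/
abbrev Elt : Type (max u v) := Σ k : K, (X k).carrier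

/-- The tuples `(x₁, …, x_n)` with `x_i ∈ 𝒳°_{k_i}`, where `w = [k₁, …, k_n]`. -/
abbrev Tuple (w : List K) : Type (max u v) := {l : List (Elt X) // l.map Sigma.fst = w}

/-- The defining relations of `𝒳°_{k₁} ⊗_B ⋯ ⊗_B 𝒳°_{k_n}` in the free vector space on tuples:
additivity and homogeneity in each slot, and `B`-balancedness in neighbouring slots. -/
inductive TensorRel (w : List K) : (Tuple X w →₀ ℂ) → Prop
  | add (s t : List (Elt X)) (k : K) (x y : (X k).carrier)
      (h : ∀ z : (X k).carrier, (s ++ ⟨k, z⟩ :: t).map Sigma.fst = w) :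
      TensorRel w (Finsupp.single ⟨s ++ ⟨k, x + y⟩ :: t, h _⟩ 1
        - (Finsupp.single ⟨s ++ ⟨k, x⟩ :: t, h _⟩ 1 + Finsupp.single ⟨s ++ ⟨k, y⟩ :: t, h _⟩ 1))
  | smul (s t : List (Elt X)) (k : K) (c : ℂ) (x : (X k).carrier)
      (h : ∀ z : (X k).carrier, (s ++ ⟨k, z⟩ :: t).map Sigma.fst = w) :
      TensorRel w (Finsupp.single ⟨s ++ ⟨k, c • x⟩ :: t, h _⟩ 1
        - c • Finsupp.single ⟨s ++ ⟨k, x⟩ :: t, h _⟩ 1)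
  | balanced (s t : List (Elt X)) (j k : K) (b : B) (x : (X j).carrier) (y : (X k).carrier)
      (h : ∀ (z : (X j).carrier) (z' : (X k).carrier),
        (s ++ ⟨j, z⟩ :: ⟨k, z'⟩ :: t).map Sigma.fst = w) :
      TensorRel w (Finsupp.single ⟨s ++ ⟨j, op b • x⟩ :: ⟨k, y⟩ :: t, h _ _⟩ 1
        - Finsupp.single ⟨s ++ ⟨j, x⟩ :: ⟨k, b • y⟩ :: t, h _ _⟩ 1)

/-- The tensor product `𝒳°_{k₁} ⊗_B ⋯ ⊗_B 𝒳°_{k_n}` for a word `w = [k₁, …, k_n]`, `n ≥ 1`. -/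
def WordTensor (w : List K) : Type (max u v) :=
  (Tuple X w →₀ ℂ) ⧸ Submodule.span ℂ {f | TensorRel X w f}

instance (w : List K) : AddCommGroup (WordTensor X w) :=
  inferInstanceAs (AddCommGroup ((Tuple X w →₀ ℂ) ⧸ Submodule.span ℂ {f | TensorRel X w f}))

instance (w : List K) : Module ℂ (WordTensor X w) :=
  inferInstanceAs (Module ℂ ((Tuple X w →₀ ℂ) ⧸ Submodule.span ℂ {f | TensorRel X w f}))

/-- The class `x₁ ⊗ ⋯ ⊗ x_n` of a tuple in `𝒳°_{k₁} ⊗_B ⋯ ⊗_B 𝒳°_{k_n}`, extended linearly. -/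
def WordTensor.mk (w : List K) : (Tuple X w →₀ ℂ) →ₗ[ℂ] WordTensor X w :=
  (Submodule.span ℂ {f | TensorRel X w f}).mkQ

theorem WordTensor.mk_eq {w : List K} {f g : Tuple X w →₀ ℂ} (h : TensorRel X w (f - g)) :
    WordTensor.mk X w f = WordTensor.mk X w g :=
  (Submodule.Quotient.eq _).2 (Submodule.subset_span h)

/-- Nonempty words `k₁ ≠ k₂ ≠ ⋯ ≠ k_n`. -/
abbrev AltWord (K : Type v) : Type v := {w : List K // w ≠ [] ∧ w.IsChain (· ≠ ·)}

/-- The complement `𝒳°` in the reduced free product: the direct sum over all alternating nonempty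
words of `𝒳°_{k₁} ⊗_B ⋯ ⊗_B 𝒳°_{k_n}`. -/
abbrev FreeProdCompl : Type (max u v) := ⨁ w : AltWord K, WordTensor X w.1

/-- The reduced free product `𝒳 = B ⊕ 𝒳°`. -/
abbrev FreeProd : Type (max u v) := B × FreeProdCompl X

open Classical in
/-- The elementary tensor `x₁ ⊗ ⋯ ⊗ x_n ∈ 𝒳` of an alternating list, the empty one being `1_B`
(and the value `0`, never used, at a list whose indices do not alternate). -/
def tensor (l : List (Elt X)) : FreeProd X :=
  if h0 : l = [] then (1, 0)
  else if h : (l.map Sigma.fst).IsChain (· ≠ ·) then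
    (0, DirectSum.lof ℂ (AltWord K) (fun w => WordTensor X w.1)
      ⟨l.map Sigma.fst, by simpa using h0, h⟩ (WordTensor.mk X _ (Finsupp.single ⟨l, rfl⟩ 1)))
  else 0

/-- A function of tuples which is linear in each slot and `B`-balanced. -/
structure IsBalanced {V : Type*} [AddCommGroup V] [Module ℂ V] (f : List (Elt X) → V) : Prop where
  add : ∀ (s t : List (Elt X)) (k : K) (x y : (X k).carrier),
    f (s ++ ⟨k, x + y⟩ :: t) = f (s ++ ⟨k, x⟩ :: t) + f (s ++ ⟨k, y⟩ :: t)
  smul : ∀ (s t : List (Elt X)) (k : K) (c : ℂ) (x : (X k).carrier),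
    f (s ++ ⟨k, c • x⟩ :: t) = c • f (s ++ ⟨k, x⟩ :: t)
  balanced : ∀ (s t : List (Elt X)) (j k : K) (b : B) (x : (X j).carrier) (y : (X k).carrier),
    f (s ++ ⟨j, op b • x⟩ :: ⟨k, y⟩ :: t) = f (s ++ ⟨j, x⟩ :: ⟨k, b • y⟩ :: t)

/-- The linear map on `𝒳°_{k₁} ⊗_B ⋯ ⊗_B 𝒳°_{k_n}` induced by a balanced multilinear function. -/
def WordTensor.lift {V : Type*} [AddCommGroup V] [Module ℂ V] (f : List (Elt X) → V)
    (hf : IsBalanced X f) (w : List K) : WordTensor X w →ₗ[ℂ] V :=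
  Submodule.liftQ _ (Finsupp.linearCombination ℂ fun t : Tuple X w => f t.1) (by
    rw [Submodule.span_le]
    rintro _ (⟨s, t, k, x, y, h⟩ | ⟨s, t, k, c, x, h⟩ | ⟨s, t, j, k, b, x, y, h⟩)
    · simp [hf.add]
    · simp [hf.smul]
    · simp [hf.balanced])

theorem WordTensor.lift_mk {V : Type*} [AddCommGroup V] [Module ℂ V] (f : List (Elt X) → V)
    (hf : IsBalanced X f) (w : List K) (t : Tuple X w) :
    WordTensor.lift X f hf w (WordTensor.mk X w (Finsupp.single t 1)) = f t.1 := by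
  change Finsupp.linearCombination ℂ (fun t : Tuple X w => f t.1) (Finsupp.single t 1) = f t.1
  simp

open Classical in
/-- The linear map on `𝒳°` with prescribed (balanced, multilinear) values on elementary tensors. -/
def liftCompl {V : Type*} [AddCommGroup V] [Module ℂ V] (f : List (Elt X) → V)
    (hf : IsBalanced X f) : FreeProdCompl X →ₗ[ℂ] V :=
  DirectSum.toModule ℂ (AltWord K) V fun w => WordTensor.lift X f hf w.1

/-- The linear map on `𝒳 = B ⊕ 𝒳°` with prescribed values on `B` and on elementary tensors. -/
def liftFree {V : Type*} [AddCommGroup V] [Module ℂ V] (g : B →ₗ[ℂ] V) (f : List (Elt X) → V)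
    (hf : IsBalanced X f) : FreeProd X →ₗ[ℂ] V :=
  g.coprod (liftCompl X f hf)

theorem tensor_nil : tensor X [] = (1, 0) := by simp [tensor]

theorem liftFree_base {V : Type*} [AddCommGroup V] [Module ℂ V] (g : B →ₗ[ℂ] V)
    (f : List (Elt X) → V) (hf : IsBalanced X f) (b : B) : liftFree X g f hf (b, 0) = g b := by
  simp [liftFree]

theorem liftFree_tensor {V : Type*} [AddCommGroup V] [Module ℂ V] (g : B →ₗ[ℂ] V)
    (f : List (Elt X) → V) (hf : IsBalanced X f) (l : List (Elt X)) (h0 : l ≠ [])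
    (h : (l.map Sigma.fst).IsChain (· ≠ ·)) : liftFree X g f hf (tensor X l) = f l := by
  simp only [tensor, dif_neg h0, dif_pos h, liftFree, LinearMap.coprod_apply, map_zero, zero_add,
    liftCompl, DirectSum.toModule_lof, WordTensor.lift_mk]

open Classical in
theorem tensor_of_word (w : List K) (hw : w ≠ [] ∧ w.IsChain (· ≠ ·)) (l : List (Elt X))
    (h : l.map Sigma.fst = w) :
    tensor X l = (0, DirectSum.lof ℂ (AltWord K) (fun w => WordTensor X w.1) ⟨w, hw⟩
      (WordTensor.mk X _ (Finsupp.single ⟨l, h⟩ 1))) := by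
  subst h
  have h0 : l ≠ [] := by simpa using hw.1
  simp only [tensor, dif_neg h0, dif_pos hw.2]

theorem tensor_of_not_alt (l : List (Elt X)) (h : ¬ (l.map Sigma.fst).IsChain (· ≠ ·)) :
    tensor X l = 0 := by
  have h0 : l ≠ [] := by rintro rfl; simp at h
  simp only [tensor, dif_neg h0, dif_neg h]

theorem isBalanced_tensor : IsBalanced X (tensor X) := by
  refine ⟨fun s t k x y => ?_, fun s t k c x => ?_, fun s t j k b x y => ?_⟩
  · have e : ∀ z : (X k).carrier, (s ++ ⟨k, z⟩ :: t).map Sigma.fst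
        = s.map Sigma.fst ++ k :: t.map Sigma.fst := fun z => by simp
    by_cases h : (s.map Sigma.fst ++ k :: t.map Sigma.fst).IsChain (· ≠ ·)
    · have key := WordTensor.mk_eq X (TensorRel.add s t k x y e)
      have hw : (s.map Sigma.fst ++ k :: t.map Sigma.fst) ≠ [] := by simp
      rw [tensor_of_word X _ ⟨hw, h⟩ _ (e _), tensor_of_word X _ ⟨hw, h⟩ _ (e _),
        tensor_of_word X _ ⟨hw, h⟩ _ (e _), key, map_add, map_add]
      simp
    · rw [tensor_of_not_alt, tensor_of_not_alt, tensor_of_not_alt, add_zero] <;> rwa [e]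
  · have e : ∀ z : (X k).carrier, (s ++ ⟨k, z⟩ :: t).map Sigma.fst
        = s.map Sigma.fst ++ k :: t.map Sigma.fst := fun z => by simp
    by_cases h : (s.map Sigma.fst ++ k :: t.map Sigma.fst).IsChain (· ≠ ·)
    · have key := WordTensor.mk_eq X (TensorRel.smul s t k c x e)
      have hw : (s.map Sigma.fst ++ k :: t.map Sigma.fst) ≠ [] := by simp
      rw [tensor_of_word X _ ⟨hw, h⟩ _ (e _), tensor_of_word X _ ⟨hw, h⟩ _ (e _),
        key, map_smul, map_smul]
      simp
    · rw [tensor_of_not_alt, tensor_of_not_alt, smul_zero] <;> rwa [e]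
  · have e : ∀ (z : (X j).carrier) (z' : (X k).carrier),
        (s ++ ⟨j, z⟩ :: ⟨k, z'⟩ :: t).map Sigma.fst
        = s.map Sigma.fst ++ j :: k :: t.map Sigma.fst := fun z z' => by simp
    by_cases h : (s.map Sigma.fst ++ j :: k :: t.map Sigma.fst).IsChain (· ≠ ·)
    · have key := WordTensor.mk_eq X (TensorRel.balanced s t j k b x y e)
      have hw : (s.map Sigma.fst ++ j :: k :: t.map Sigma.fst) ≠ [] := by simp
      rw [tensor_of_word X _ ⟨hw, h⟩ _ (e _ _), tensor_of_word X _ ⟨hw, h⟩ _ (e _ _), key]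
    · rw [tensor_of_not_alt, tensor_of_not_alt] <;> rwa [e]

theorem IsBalanced.comp {V W : Type*} [AddCommGroup V] [Module ℂ V] [AddCommGroup W] [Module ℂ W]
    {f : List (Elt X) → V} (hf : IsBalanced X f) (T : V →ₗ[ℂ] W) :
    IsBalanced X (fun l => T (f l)) :=
  ⟨fun s t k x y => by simp [hf.add], fun s t k c x => by simp [hf.smul],
    fun s t j k b x y => by simp [hf.balanced]⟩

theorem IsBalanced.sum {V : Type*} [AddCommGroup V] [Module ℂ V] {f g : List (Elt X) → V}
    (hf : IsBalanced X f) (hg : IsBalanced X g) : IsBalanced X (fun l => f l + g l) :=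
  ⟨fun s t k x y => by simp only [hf.add, hg.add]; abel,
    fun s t k c x => by simp only [hf.smul, hg.smul, smul_add],
    fun s t j k b x y => by simp only [hf.balanced, hg.balanced]⟩

theorem IsBalanced.consList {V : Type*} [AddCommGroup V] [Module ℂ V] {f : List (Elt X) → V}
    (hf : IsBalanced X f) (e : Elt X) : IsBalanced X (fun l => f (e :: l)) :=
  ⟨fun s t => hf.add (e :: s) t, fun s t => hf.smul (e :: s) t,
    fun s t => hf.balanced (e :: s) t⟩

theorem IsBalanced.snocList {V : Type*} [AddCommGroup V] [Module ℂ V] {f : List (Elt X) → V}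
    (hf : IsBalanced X f) (e : Elt X) : IsBalanced X (fun l => f (l ++ [e])) :=
  ⟨fun s t k x y => by simpa using hf.add s (t ++ [e]) k x y,
    fun s t k c x => by simpa using hf.smul s (t ++ [e]) k c x,
    fun s t j k b x y => by simpa using hf.balanced s (t ++ [e]) j k b x y⟩

/-- `b ⋅ (x₁ ⊗ ⋯ ⊗ x_n) = (b x₁) ⊗ ⋯ ⊗ x_n`. -/
def lmulList (b : B) : List (Elt X) → FreeProd X
  | [] => (b, 0)
  | ⟨k, x⟩ :: t => tensor X (⟨k, b • x⟩ :: t)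

theorem isBalanced_lmulList (b : B) : IsBalanced X (lmulList X b) := by
  have ht := isBalanced_tensor X
  refine ⟨fun s t k x y => ?_, fun s t k c x => ?_, fun s t j k b' x y => ?_⟩
  · rcases s with _ | ⟨⟨i, z⟩, s⟩
    · simpa [lmulList, smul_add] using ht.add [] t k (b • x) (b • y)
    · exact ht.add (⟨i, b • z⟩ :: s) t k x y
  · rcases s with _ | ⟨⟨i, z⟩, s⟩
    · simpa [lmulList, left_smul_complex] using ht.smul [] t k c (b • x)
    · exact ht.smul (⟨i, b • z⟩ :: s) t k c x
  · rcases s with _ | ⟨⟨i, z⟩, s⟩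
    · simpa [lmulList, smul_comm b (op b')] using ht.balanced [] t j k b' (b • x) y
    · exact ht.balanced (⟨i, b • z⟩ :: s) t j k b' x y

/-- `(x₁ ⊗ ⋯ ⊗ x_n) ⋅ b = x₁ ⊗ ⋯ ⊗ (x_n b)`. -/
def rmulList (b : B) (l : List (Elt X)) : FreeProd X :=
  match l.reverse with
  | [] => (b, 0)
  | ⟨k, x⟩ :: t => tensor X (t.reverse ++ [⟨k, op b • x⟩])

theorem rmulList_snoc (b : B) (t : List (Elt X)) (k : K) (x : (X k).carrier) :
    rmulList X b (t ++ [⟨k, x⟩]) = tensor X (t ++ [⟨k, op b • x⟩]) := by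
  simp [rmulList]

theorem isBalanced_rmulList (b : B) : IsBalanced X (rmulList X b) := by
  have ht := isBalanced_tensor X
  refine ⟨fun s t k x y => ?_, fun s t k c x => ?_, fun s t j k b' x y => ?_⟩
  · rcases List.eq_nil_or_concat t with rfl | ⟨t, ⟨i, z⟩, rfl⟩
    · simp only [rmulList_snoc, smul_add]
      exact ht.add s [] k (op b • x) (op b • y)
    · simp only [List.concat_eq_append, ← List.cons_append, ← List.append_assoc, rmulList_snoc]
      simpa using ht.add s (t ++ [⟨i, op b • z⟩]) k x y
  · rcases List.eq_nil_or_concat t with rfl | ⟨t, ⟨i, z⟩, rfl⟩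
    · simp only [rmulList_snoc, right_smul_complex]
      exact ht.smul s [] k c (op b • x)
    · simp only [List.concat_eq_append, ← List.cons_append, ← List.append_assoc, rmulList_snoc]
      simpa using ht.smul s (t ++ [⟨i, op b • z⟩]) k c x
  · rcases List.eq_nil_or_concat t with rfl | ⟨t, ⟨i, z⟩, rfl⟩
    · have h1 := rmulList_snoc X b (s ++ [⟨j, op b' • x⟩]) k y
      have h2 := rmulList_snoc X b (s ++ [⟨j, x⟩]) k (b' • y)
      simp only [List.append_assoc, List.cons_append, List.nil_append] at h1 h2
      rw [h1, h2, ← smul_comm b' (op b) y]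
      exact ht.balanced s [] j k b' x (op b • y)
    · simp only [List.concat_eq_append, ← List.cons_append, ← List.append_assoc, rmulList_snoc]
      simpa using ht.balanced s (t ++ [⟨i, op b • z⟩]) j k b' x y

theorem lmulList_add (b c : B) (l : List (Elt X)) :
    lmulList X (b + c) l = lmulList X b l + lmulList X c l := by
  rcases l with _ | ⟨⟨k, x⟩, t⟩
  · simp [lmulList]
  · simpa [lmulList, add_smul] using (isBalanced_tensor X).add [] t k (b • x) (c • x)

theorem lmulList_smul (c : ℂ) (b : B) (l : List (Elt X)) :
    lmulList X (c • b) l = c • lmulList X b l := by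
  rcases l with _ | ⟨⟨k, x⟩, t⟩
  · simp [lmulList]
  · simpa [lmulList, smul_assoc] using (isBalanced_tensor X).smul [] t k c (b • x)

theorem rmulList_add (b c : B) (l : List (Elt X)) :
    rmulList X (b + c) l = rmulList X b l + rmulList X c l := by
  rcases List.eq_nil_or_concat l with rfl | ⟨t, ⟨k, x⟩, rfl⟩
  · simp [rmulList]
  · simpa [rmulList_snoc, add_smul] using
      (isBalanced_tensor X).add t [] k (op b • x) (op c • x)

theorem rmulList_smul (c : ℂ) (b : B) (l : List (Elt X)) :
    rmulList X (c • b) l = c • rmulList X b l := by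
  rcases List.eq_nil_or_concat l with rfl | ⟨t, ⟨k, x⟩, rfl⟩
  · simp [rmulList]
  · simpa [rmulList_snoc, smul_assoc] using
      (isBalanced_tensor X).smul t [] k c (op b • x)

/-- The isomorphism `V_k⁻¹ : 𝒳_k ⊗_B 𝒳_ℓ(k) → 𝒳` at `ξ ⊗ (x₁ ⊗ ⋯ ⊗ x_n)`, `ξ = β ⊕ x`:
it is `β x₁ ⊗ ⋯ ⊗ x_n + x ⊗ x₁ ⊗ ⋯ ⊗ x_n`. -/
def joinLeft (k : K) (l : List (Elt X)) : (X k).Total →ₗ[ℂ] FreeProd X where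
  toFun ξ := lmulList X ξ.1 l + tensor X (⟨k, ξ.2⟩ :: l)
  map_add' ξ η := by
    have := (isBalanced_tensor X).add [] l k ξ.2 η.2
    simp only [List.nil_append] at this
    simp only [Prod.fst_add, Prod.snd_add, lmulList_add, this]
    abel
  map_smul' c ξ := by
    have := (isBalanced_tensor X).smul [] l k c ξ.2
    simp only [List.nil_append] at this
    simp only [Prod.smul_fst, Prod.smul_snd, lmulList_smul, this, smul_add, RingHom.id_apply]

/-- The isomorphism `W_k⁻¹ : 𝒳_r(k) ⊗_B 𝒳_k → 𝒳` at `(x₁ ⊗ ⋯ ⊗ x_n) ⊗ ξ`, `ξ = β ⊕ x`: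
it is `x₁ ⊗ ⋯ ⊗ x_n β + x₁ ⊗ ⋯ ⊗ x_n ⊗ x`. -/
def joinRight (k : K) (l : List (Elt X)) : (X k).Total →ₗ[ℂ] FreeProd X where
  toFun ξ := rmulList X ξ.1 l + tensor X (l ++ [⟨k, ξ.2⟩])
  map_add' ξ η := by
    have := (isBalanced_tensor X).add l [] k ξ.2 η.2
    simp only [Prod.fst_add, Prod.snd_add, rmulList_add, this]
    abel
  map_smul' c ξ := by
    have := (isBalanced_tensor X).smul l [] k c ξ.2
    simp only [Prod.smul_fst, Prod.smul_snd, rmulList_smul, this, smul_add, RingHom.id_apply]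

theorem isBalanced_joinLeft (k : K) (ξ : (X k).Total) :
    IsBalanced X (fun l => joinLeft X k l ξ) :=
  (isBalanced_lmulList X ξ.1).sum X ((isBalanced_tensor X).consList X ⟨k, ξ.2⟩)

theorem isBalanced_joinRight (k : K) (ξ : (X k).Total) :
    IsBalanced X (fun l => joinRight X k l ξ) :=
  (isBalanced_rmulList X ξ.1).sum X ((isBalanced_tensor X).snocList X ⟨k, ξ.2⟩)

theorem joinLeft_balanced (k i : K) (ξ : (X k).Total) (b : B) (y : (X i).carrier)
    (t : List (Elt X)) :
    joinLeft X k (⟨i, y⟩ :: t) (op b • ξ) = joinLeft X k (⟨i, b • y⟩ :: t) ξ := by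
  have := (isBalanced_tensor X).balanced [] t k i b ξ.2 y
  simp only [List.nil_append] at this
  simp [joinLeft, lmulList, this, mul_smul]

theorem joinRight_balanced (k i : K) (ξ : (X k).Total) (b : B) (y : (X i).carrier)
    (t : List (Elt X)) :
    joinRight X k (t ++ [⟨i, op b • y⟩]) ξ = joinRight X k (t ++ [⟨i, y⟩]) (b • ξ) := by
  have := (isBalanced_tensor X).balanced t [] i k b y ξ.2
  simp [joinRight, rmulList_snoc, this, mul_smul]

open Classical in
/-- `V_k⁻¹ (a ⊗ Id) V_k` on elementary tensors: `V_k (x₁ ⊗ ⋯ ⊗ x_n)` is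
`(0 ⊕ x₁) ⊗ (x₂ ⊗ ⋯ ⊗ x_n)` if `x₁ ∈ 𝒳°_k`, and `(1_B ⊕ 0) ⊗ (x₁ ⊗ ⋯ ⊗ x_n)` otherwise. -/
def lambdaList (k : K) (a : (X k).Op) : List (Elt X) → FreeProd X
  | [] => joinLeft X k [] (a (1, 0))
  | ⟨j, x⟩ :: t =>
    if h : j = k then joinLeft X k t (a (0, h ▸ x))
    else joinLeft X k (⟨j, x⟩ :: t) (a (1, 0))

open Classical in
/-- `W_k⁻¹ (Id ⊗ a) W_k` on elementary tensors: `W_k (x₁ ⊗ ⋯ ⊗ x_n)` is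
`(x₁ ⊗ ⋯ ⊗ x_{n-1}) ⊗ (0 ⊕ x_n)` if `x_n ∈ 𝒳°_k`, and `(x₁ ⊗ ⋯ ⊗ x_n) ⊗ (1_B ⊕ 0)` otherwise. -/
def rhoList (k : K) (a : (X k).Op) (l : List (Elt X)) : FreeProd X :=
  match l.reverse with
  | [] => joinRight X k [] (a (1, 0))
  | ⟨j, x⟩ :: t =>
    if h : j = k then joinRight X k t.reverse (a (0, h ▸ x))
    else joinRight X k (t.reverse ++ [⟨j, x⟩]) (a (1, 0))

theorem lambdaList_self (k : K) (a : (X k).Op) (x : (X k).carrier) (t : List (Elt X)) :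
    lambdaList X k a (⟨k, x⟩ :: t) = joinLeft X k t (a (0, x)) := by
  simp [lambdaList]

theorem lambdaList_ne (k j : K) (a : (X k).Op) (x : (X j).carrier) (t : List (Elt X))
    (h : j ≠ k) :
    lambdaList X k a (⟨j, x⟩ :: t) = joinLeft X k (⟨j, x⟩ :: t) (a (1, 0)) := by
  simp [lambdaList, h]

theorem rhoList_self (k : K) (a : (X k).Op) (x : (X k).carrier) (t : List (Elt X)) :
    rhoList X k a (t ++ [⟨k, x⟩]) = joinRight X k t (a (0, x)) := by
  simp [rhoList]

theorem rhoList_ne (k j : K) (a : (X k).Op) (x : (X j).carrier) (t : List (Elt X))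
    (h : j ≠ k) :
    rhoList X k a (t ++ [⟨j, x⟩]) = joinRight X k (t ++ [⟨j, x⟩]) (a (1, 0)) := by
  simp [rhoList, h]

theorem isBalanced_lambdaList (k : K) (a : (X k).leftAlg) :
    IsBalanced X (lambdaList X k a.1) := by
  refine ⟨fun s t i x y => ?_, fun s t i c x => ?_, fun s t j i b x y => ?_⟩
  · rcases s with _ | ⟨⟨j, z⟩, s⟩
    · by_cases h : i = k
      · subst h
        simp only [List.nil_append, lambdaList_self, ← map_add, Prod.mk_add_mk, add_zero]
      · simp only [List.nil_append, lambdaList_ne X k i _ _ _ h]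
        exact (isBalanced_joinLeft X k _).add [] t i x y
    · by_cases h : j = k
      · subst h
        simp only [List.cons_append, lambdaList_self]
        exact (isBalanced_joinLeft X j _).add s t i x y
      · simp only [List.cons_append, lambdaList_ne X k j _ _ _ h]
        exact (isBalanced_joinLeft X k _).add (⟨j, z⟩ :: s) t i x y
  · rcases s with _ | ⟨⟨j, z⟩, s⟩
    · by_cases h : i = k
      · subst h
        simp only [List.nil_append, lambdaList_self, ← map_smul, Prod.smul_mk, smul_zero]
      · simp only [List.nil_append, lambdaList_ne X k i _ _ _ h]
        exact (isBalanced_joinLeft X k _).smul [] t i c x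
    · by_cases h : j = k
      · subst h
        simp only [List.cons_append, lambdaList_self]
        exact (isBalanced_joinLeft X j _).smul s t i c x
      · simp only [List.cons_append, lambdaList_ne X k j _ _ _ h]
        exact (isBalanced_joinLeft X k _).smul (⟨j, z⟩ :: s) t i c x
  · rcases s with _ | ⟨⟨m, z⟩, s⟩
    · by_cases h : j = k
      · subst h
        have e : ((0, op b • x) : (X j).Total) = op b • (0, x) := by simp
        simp only [List.nil_append, lambdaList_self]
        rw [e, leftAlg_apply, joinLeft_balanced]
      · simp only [List.nil_append, lambdaList_ne X k j _ _ _ h]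
        exact (isBalanced_joinLeft X k _).balanced [] t j i b x y
    · by_cases h : m = k
      · subst h
        simp only [List.cons_append, lambdaList_self]
        exact (isBalanced_joinLeft X m _).balanced s t j i b x y
      · simp only [List.cons_append, lambdaList_ne X k m _ _ _ h]
        exact (isBalanced_joinLeft X k _).balanced (⟨m, z⟩ :: s) t j i b x y

theorem isBalanced_rhoList (k : K) (a : (X k).rightAlg) :
    IsBalanced X (rhoList X k a.1) := by
  refine ⟨fun s t i x y => ?_, fun s t i c x => ?_, fun s t j i b x y => ?_⟩
  · rcases List.eq_nil_or_concat t with rfl | ⟨t, ⟨j, z⟩, rfl⟩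
    · by_cases h : i = k
      · subst h
        simp only [rhoList_self, ← map_add, Prod.mk_add_mk, add_zero]
      · simp only [rhoList_ne X k i _ _ _ h]
        exact (isBalanced_joinRight X k _).add s [] i x y
    · simp only [List.concat_eq_append, ← List.cons_append, ← List.append_assoc]
      by_cases h : j = k
      · subst h
        simp only [rhoList_self]
        exact (isBalanced_joinRight X j _).add s t i x y
      · simp only [rhoList_ne X k j _ _ _ h]
        simpa using (isBalanced_joinRight X k _).add s (t ++ [⟨j, z⟩]) i x y
  · rcases List.eq_nil_or_concat t with rfl | ⟨t, ⟨j, z⟩, rfl⟩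
    · by_cases h : i = k
      · subst h
        simp only [rhoList_self, ← map_smul, Prod.smul_mk, smul_zero]
      · simp only [rhoList_ne X k i _ _ _ h]
        exact (isBalanced_joinRight X k _).smul s [] i c x
    · simp only [List.concat_eq_append, ← List.cons_append, ← List.append_assoc]
      by_cases h : j = k
      · subst h
        simp only [rhoList_self]
        exact (isBalanced_joinRight X j _).smul s t i c x
      · simp only [rhoList_ne X k j _ _ _ h]
        simpa using (isBalanced_joinRight X k _).smul s (t ++ [⟨j, z⟩]) i c x
  · rcases List.eq_nil_or_concat t with rfl | ⟨t, ⟨m, z⟩, rfl⟩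
    · have e1 : ∀ (u : (X j).carrier) (w : (X i).carrier),
          s ++ [⟨j, u⟩, ⟨i, w⟩] = (s ++ [⟨j, u⟩]) ++ [(⟨i, w⟩ : Elt X)] := by simp
      rw [e1, e1]
      by_cases h : i = k
      · subst h
        have e : ((0, b • y) : (X i).Total) = b • (0, y) := by simp
        simp only [rhoList_self]
        rw [e, rightAlg_apply, joinRight_balanced]
      · rw [rhoList_ne X k i _ _ _ h, rhoList_ne X k i _ _ _ h, ← e1, ← e1]
        exact (isBalanced_joinRight X k _).balanced s [] j i b x y
    · simp only [List.concat_eq_append, ← List.cons_append, ← List.append_assoc]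
      by_cases h : m = k
      · subst h
        simp only [rhoList_self]
        exact (isBalanced_joinRight X m _).balanced s t j i b x y
      · simp only [rhoList_ne X k m _ _ _ h]
        simpa using (isBalanced_joinRight X k _).balanced s (t ++ [⟨m, z⟩]) j i b x y

/-- The left regular representation `λ_k(a) = V_k⁻¹ (a ⊗ Id) V_k`; the operator `a ⊗ Id` on
`𝒳_k ⊗_B 𝒳_ℓ(k)` makes sense for `a ∈ ℒ_ℓ(𝒳_k)`. -/
def lambda (k : K) (a : (X k).leftAlg) : Module.End ℂ (FreeProd X) :=
  liftFree X (joinLeft X k [] ∘ₗ a.1 ∘ₗ LinearMap.inl ℂ B (X k).carrier) (lambdaList X k a.1)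
    (isBalanced_lambdaList X k a)

/-- The right regular representation `ρ_k(a) = W_k⁻¹ (Id ⊗ a) W_k`; the operator `Id ⊗ a` on
`𝒳_r(k) ⊗_B 𝒳_k` makes sense for `a ∈ ℒ_r(𝒳_k)`. -/
def rho (k : K) (a : (X k).rightAlg) : Module.End ℂ (FreeProd X) :=
  liftFree X (joinRight X k [] ∘ₗ a.1 ∘ₗ LinearMap.inl ℂ B (X k).carrier) (rhoList X k a.1)
    (isBalanced_rhoList X k a)

/-- The inclusion of `𝒳_k = B ⊕ 𝒳°_k` in the reduced free product. -/
def incl (k : K) : (X k).Total →ₗ[ℂ] FreeProd X := joinLeft X k []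

open Classical in
/-- The coordinate in `𝒳°_k` of an elementary tensor (zero unless it has the one factor `k`). -/
def projList (k : K) : List (Elt X) → (X k).Total
  | [⟨j, x⟩] => if h : j = k then (0, h ▸ x) else 0
  | _ => 0

theorem isBalanced_projList (k : K) : IsBalanced X (projList X k) := by
  refine ⟨fun s t i x y => ?_, fun s t i c x => ?_, fun s t j i b x y => ?_⟩
  · rcases s with _ | ⟨e, _ | ⟨e', s⟩⟩ <;> rcases t with _ | ⟨f, t⟩ <;> simp [projList]
    by_cases h : i = k
    · subst h; simp
    · simp [h]
  · rcases s with _ | ⟨e, _ | ⟨e', s⟩⟩ <;> rcases t with _ | ⟨f, t⟩ <;> simp [projList]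
    by_cases h : i = k
    · subst h; simp
    · simp [h]
  · rcases s with _ | ⟨e, _ | ⟨e', s⟩⟩ <;> simp [projList]

/-- The map `𝒳 → 𝒳_k = B ⊕ 𝒳°_k` which forgets all the other direct summands of `𝒳`. -/
def proj (k : K) : FreeProd X →ₗ[ℂ] (X k).Total :=
  liftFree X (LinearMap.inl ℂ B (X k).carrier) (projList X k) (isBalanced_projList X k)

/-- The `k`-th Boolean projection `P_k`, the natural projection of `𝒳` onto `B ⊕ 𝒳°_k`. -/
def boolProj (k : K) : Module.End ℂ (FreeProd X) := incl X k ∘ₗ proj X k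

/-- The operator `P_k λ_k(T) P_k`. As `λ_k(T)` acts on `B ⊕ 𝒳°_k = 𝒳_k` by `T`, it makes sense for
every `T ∈ ℒ(𝒳_k)`, and it is the composite `𝒳 → 𝒳_k → 𝒳_k → 𝒳` with `T` in the middle
(see `boolAct_eq` for `T ∈ ℒ_ℓ(𝒳_k)`). -/
def boolAct (k : K) (T : (X k).Op) : Module.End ℂ (FreeProd X) :=
  incl X k ∘ₗ T ∘ₗ proj X k

theorem proj_incl (k : K) (ξ : (X k).Total) : proj X k (incl X k ξ) = ξ := by
  have h1 : proj X k (tensor X [⟨k, ξ.2⟩]) = (0, ξ.2) := by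
    rw [proj, liftFree_tensor _ _ _ _ _ (by simp) (by simp)]; simp [projList]
  have h2 : proj X k (ξ.1, 0) = (ξ.1, 0) := by rw [proj, liftFree_base]; rfl
  change proj X k (lmulList X ξ.1 [] + tensor X [⟨k, ξ.2⟩]) = ξ
  rw [map_add, h1, lmulList, h2]
  simp

theorem lambda_incl (k : K) (a : (X k).leftAlg) (ξ : (X k).Total) :
    lambda X k a (incl X k ξ) = incl X k (a.1 ξ) := by
  have h1 : lambda X k a (tensor X [⟨k, ξ.2⟩]) = incl X k (a.1 (0, ξ.2)) := by
    rw [lambda, liftFree_tensor _ _ _ _ _ (by simp) (by simp), lambdaList_self]; rfl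
  have h2 : lambda X k a (ξ.1, 0) = incl X k (a.1 (ξ.1, 0)) := by
    rw [lambda, liftFree_base]; rfl
  change lambda X k a (lmulList X ξ.1 [] + tensor X [⟨k, ξ.2⟩]) = _
  rw [map_add, h1, lmulList, h2, ← map_add, ← map_add]
  simp

theorem boolAct_eq (k : K) (a : (X k).leftAlg) :
    boolAct X k a.1 = boolProj X k * lambda X k a * boolProj X k := by
  refine LinearMap.ext fun η => ?_
  simp [boolAct, boolProj, lambda_incl, proj_incl]

end FreeProduct

/-! ## `B`-`B`-non-commutative probability spaces and triples of `B`-faces -/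

section Spaces

variable (B 𝒜 : Type u) [Ring B] [Algebra ℂ B] [Ring 𝒜] [Algebra ℂ 𝒜]

/-- A `B`-`B`-non-commutative probability space `(𝒜, E, ε)`. -/
structure BBSpace where
  ε : B ⊗[ℂ] Bᵐᵒᵖ →ₐ[ℂ] 𝒜
  ε_left_injective : Function.Injective fun b : B => ε (b ⊗ₜ[ℂ] 1)
  ε_right_injective : Function.Injective fun b : B => ε (1 ⊗ₜ[ℂ] op b)
  E : 𝒜 →ₗ[ℂ] B
  E_bimodule : ∀ (b₁ b₂ : B) (T : 𝒜), E (ε (b₁ ⊗ₜ[ℂ] op b₂) * T) = b₁ * E T * b₂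
  E_balanced : ∀ (b : B) (T : 𝒜), E (T * ε (b ⊗ₜ[ℂ] 1)) = E (T * ε (1 ⊗ₜ[ℂ] op b))

end Spaces

section Faces

variable {B 𝒜 : Type u} [Ring B] [Algebra ℂ B] [Ring 𝒜] [Algebra ℂ 𝒜]

/-- `L_b = ε (b ⊗ 1)`. -/
def BBSpace.L (S : BBSpace B 𝒜) (b : B) : 𝒜 := S.ε (b ⊗ₜ[ℂ] 1)

/-- `R_b = ε (1 ⊗ b)`. -/
def BBSpace.R (S : BBSpace B 𝒜) (b : B) : 𝒜 := S.ε (1 ⊗ₜ[ℂ] op b)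

/-- The left algebra `𝒜_ℓ`, the commutant of all `R_b`. -/
def BBSpace.leftAlg (S : BBSpace B 𝒜) : Subalgebra ℂ 𝒜 :=
  Subalgebra.centralizer ℂ (Set.range S.R)

/-- The right algebra `𝒜_r`, the commutant of all `L_b`. -/
def BBSpace.rightAlg (S : BBSpace B 𝒜) : Subalgebra ℂ 𝒜 :=
  Subalgebra.centralizer ℂ (Set.range S.L)

/-- A triple of `B`-faces `(A^ℓ, A^r, A^b)`; the third algebra need not be unital. -/
structure FaceTriple (S : BBSpace B 𝒜) where
  left : Subalgebra ℂ 𝒜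
  right : Subalgebra ℂ 𝒜
  bool : NonUnitalSubalgebra ℂ 𝒜
  L_mem : ∀ b, S.L b ∈ left
  left_le : left ≤ S.leftAlg
  R_mem : ∀ b, S.R b ∈ right
  right_le : right ≤ S.rightAlg
  bool_stable : ∀ (b₁ b₂ : B), ∀ d ∈ bool, S.L b₁ * d * S.L b₂ ∈ bool
  bool_le : ∀ d ∈ bool, d ∈ S.leftAlg

/-- A letter from a triple of faces: an element of one of its three algebras, together with the
information which of the three it is taken from. -/
inductive Letter {S : BBSpace B 𝒜} (A : FaceTriple S) : Type u
  | left (z : A.left)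
  | right (z : A.right)
  | bool (z : A.bool)

/-- The element of `𝒜` which a letter stands for. -/
def Letter.val {S : BBSpace B 𝒜} {A : FaceTriple S} : Letter A → 𝒜
  | .left z => z
  | .right z => z
  | .bool z => z

/-- The joint distribution of one triple of faces, given by its moments `E (Z₁ ⋯ Z_n)`. -/
def FaceTriple.dist {S : BBSpace B 𝒜} (A : FaceTriple S) (w : List (Letter A)) : B :=
  S.E (w.map Letter.val).prod

/-- The joint distribution `μ_Γ` of a family of triples of faces, given by its moments
`E (Z₁ ⋯ Z_n)`, where the `Z_i` come from the triples of arbitrary (varying) indices. -/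
def jointDist {S : BBSpace B 𝒜} {K : Type v} (Γ : K → FaceTriple S)
    (w : List (Σ k, Letter (Γ k))) : B :=
  S.E (w.map fun Z => Z.2.val).prod

/-- A representation of a triple of faces on a bimodule with specified projection: unital
homomorphisms into `ℒ_ℓ(𝒳)` and `ℒ_r(𝒳)` which respect the copies of `B`, and a not necessarily
unital homomorphism into `ℒ(𝒳)`. -/
structure FaceRep {S : BBSpace B 𝒜} (A : FaceTriple S) (M : Bimod B) where
  ℓ : A.left →ₐ[ℂ] M.leftAlg
  r : A.right →ₐ[ℂ] M.rightAlg
  m : A.bool →ₙₐ[ℂ] M.Op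
  ℓ_L : ∀ b, (ℓ ⟨S.L b, A.L_mem b⟩ : M.Op) = M.L b
  r_R : ∀ b, (r ⟨S.R b, A.R_mem b⟩ : M.Op) = M.R b

/-- The operator on `𝒳` by which a letter acts in a representation. -/
def FaceRep.act {S : BBSpace B 𝒜} {A : FaceTriple S} {M : Bimod B} (ρ : FaceRep A M) :
    Letter A → M.Op
  | .left z => (ρ.ℓ z).1
  | .right z => (ρ.r z).1
  | .bool z => ρ.m z

/-- The joint distribution of the image `(ℓ(A^ℓ), r(A^r), m(A^b))` of a triple, in `ℒ(𝒳)`. -/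
def FaceRep.dist {S : BBSpace B 𝒜} {A : FaceTriple S} {M : Bimod B} (ρ : FaceRep A M)
    (w : List (Letter A)) : B :=
  vacuumExp (w.map ρ.act).prod

/-- The operator on the reduced free product by which a letter of the `k`-th triple acts:
`λ_k(ℓ_k(z))`, `ρ_k(r_k(z))` or `P_k λ_k(m_k(z)) P_k`. -/
def freeAct {S : BBSpace B 𝒜} {K : Type v} {Γ : K → FaceTriple S} {X : K → Bimod B}
    (ρ : ∀ k, FaceRep (Γ k) (X k)) : (Σ k, Letter (Γ k)) → Module.End ℂ (FreeProd X)
  | ⟨k, .left z⟩ => lambda X k ((ρ k).ℓ z)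
  | ⟨k, .right z⟩ => rho X k ((ρ k).r z)
  | ⟨k, .bool z⟩ => boolAct X k ((ρ k).m z)

/-- The joint distribution, in `(ℒ(𝒳), E)` with `𝒳` the reduced free product, of the family
`{(λ_k(ℓ_k(A^ℓ_k)), ρ_k(r_k(A^r_k)), P_k λ_k(m_k(A^b_k)) P_k)}`. -/
def freeDist {S : BBSpace B 𝒜} {K : Type v} {Γ : K → FaceTriple S} {X : K → Bimod B}
    (ρ : ∀ k, FaceRep (Γ k) (X k)) (w : List (Σ k, Letter (Γ k))) : B :=
  vacuumExp (w.map (freeAct ρ)).prod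

/-- The family `Γ` is free-free-Boolean independent over `B` by means of the representations `ρ`:
its joint distribution is the one of the represented family on the reduced free product. -/
def IsFFBVia {S : BBSpace B 𝒜} {K : Type v} (Γ : K → FaceTriple S) {X : K → Bimod B}
    (ρ : ∀ k, FaceRep (Γ k) (X k)) : Prop :=
  jointDist Γ = freeDist ρ

/-- The family `Γ` is free-free-Boolean independent with amalgamation over `B`. -/
def IsFFB {S : BBSpace B 𝒜} {K : Type v} (Γ : K → FaceTriple S) : Prop :=
  ∃ (X : K → Bimod B) (ρ : ∀ k, FaceRep (Γ k) (X k)), IsFFBVia Γ ρ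

end Faces

section Images

variable {B 𝒜 𝒜' : Type u} [Ring B] [Algebra ℂ B] [Ring 𝒜] [Algebra ℂ 𝒜] [Ring 𝒜'] [Algebra ℂ 𝒜']

/-- Homomorphisms of the three algebras of a triple of faces onto those of another triple of faces
(possibly of another space over `B`), respecting the copies of `B`. -/
structure FaceImage {S : BBSpace B 𝒜} (A : FaceTriple S) {S' : BBSpace B 𝒜'} (A' : FaceTriple S')
    where
  left : A.left →ₐ[ℂ] A'.left
  right : A.right →ₐ[ℂ] A'.right
  bool : A.bool →ₙₐ[ℂ] A'.bool
  left_surjective : Function.Surjective left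
  right_surjective : Function.Surjective right
  bool_surjective : Function.Surjective bool
  left_L : ∀ b, (left ⟨S.L b, A.L_mem b⟩ : 𝒜') = S'.L b
  right_R : ∀ b, (right ⟨S.R b, A.R_mem b⟩ : 𝒜') = S'.R b

/-- The image of a letter. -/
def FaceImage.map {S : BBSpace B 𝒜} {A : FaceTriple S} {S' : BBSpace B 𝒜'} {A' : FaceTriple S'}
    (φ : FaceImage A A') : Letter A → Letter A'
  | .left z => .left (φ.left z)
  | .right z => .right (φ.right z)
  | .bool z => .bool (φ.bool z)

end Images

end FFB

end

open FFB

noncomputable section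

namespace FFB

/-! ## Pairs of operators on two reduced free products -/

section Pairs

variable {B : Type u} [Ring B] [Algebra ℂ B]

/-! The core is `freeDist_congr`: the distribution on the reduced free product depends only on the
distributions of the single represented triples. Two representations of one triple with equal
distributions need not be linked by a linear map, since a polynomial in the letters may kill the
vacuum on one side only. They are linked by a linear relation, spanned by the pairs (T 1, T' 1) for
corresponding words T, T'. It is stable under all letters, hence under both actions of B, and
equality of distributions says exactly that related vectors have the same B-component
(`FaceRep.bimodRel`).

Such relations, one for each index, induce a relation between the free products, spanned by the
diagonal of B and by pairs of elementary tensors with related entries (`freeRel`). The operators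
λ_k(a), ρ_k(a) and P_k λ_k(T) P_k for corresponding letters preserve it, and related vectors again
have the same B-component (`fst_eq_of_mem_freeRel`). Applying a word to the pair of vacuum vectors
therefore gives equal moments.

Conversely, the copy of 𝒳_k in the free product is invariant under the letters of index k, so
independence via any representations forces them to have the correct single distributions
(`IsFFBVia.dist_eq`). Hence they can be exchanged for the given ones, which is `IsFFB.via` and
yields the first two claims.

For the third claim, representations of Γ' pull back to Γ without changing moments. The one
direction this does not settle is from Γ to Γ', because a representation of Γ need not factor
through the homomorphisms. There Γ' gets a representation of its own with the right distributions:
𝒜' acts by right translation on the B-bilinear maps f : 𝒜' → B, with E as vacuum vector and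
evaluation at 1 as projection (`FaceTriple.stdRep`). This needs E 1 = 1, which follows from
independence by looking at the empty word. -/

/-- A linear relation between two bimodules with specified projection which contains the pair of
vacuum vectors, is stable under both actions of `B`, and respects the projections. -/
structure BimodRel (M N : Bimod B) where
  rel : Submodule ℂ (M.Total × N.Total)
  one_mem : ((1, 0), (1, 0)) ∈ rel
  L_mem : ∀ (b : B), ∀ q ∈ rel, (b • q.1, b • q.2) ∈ rel
  R_mem : ∀ (b : B), ∀ q ∈ rel, (op b • q.1, op b • q.2) ∈ rel
  fst_eq : ∀ q ∈ rel, q.1.1 = q.2.1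

theorem BimodRel.base_mem {M N : Bimod B} (R : BimodRel M N) (b : B) :
    (((b, 0), (b, 0)) : M.Total × N.Total) ∈ R.rel := by
  simpa using R.L_mem b _ R.one_mem

/-- The complements of related vectors are related. -/
theorem BimodRel.snd_mem {M N : Bimod B} (R : BimodRel M N) {q : M.Total × N.Total}
    (hq : q ∈ R.rel) : ((0, q.1.2), (0, q.2.2)) ∈ R.rel := by
  -- Both B-components agree, so subtracting one diagonal pair removes them simultaneously.
  have h := R.rel.sub_mem hq (R.base_mem q.1.1)
  have e : q - ((q.1.1, 0), (q.1.1, 0)) = ((0, q.1.2), (0, q.2.2)) := by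
    ext <;> simp [R.fst_eq q hq]
  rwa [e] at h

variable {K : Type v} {X Y : K → Bimod B} (R : ∀ k, BimodRel (X k) (Y k))

/-- A pair of related elements of the complements `𝒳°_k` and `𝒴°_k`. -/
structure RelElt where
  idx : K
  fst : (X idx).carrier
  snd : (Y idx).carrier
  mem : ((0, fst), (0, snd)) ∈ (R idx).rel

variable {R}

/-- The first element of a related pair. -/
def RelElt.left (e : RelElt R) : Elt X := ⟨e.idx, e.fst⟩

/-- The second element of a related pair. -/
def RelElt.right (e : RelElt R) : Elt Y := ⟨e.idx, e.snd⟩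

theorem RelElt.map_idx (P : List (RelElt R)) :
    (P.map RelElt.left).map Sigma.fst = (P.map RelElt.right).map Sigma.fst := by
  simp [Function.comp_def, RelElt.left, RelElt.right]

variable (R)

/-- The relation between the reduced free products generated by elementary tensors of related
elements. -/
def freeRel : Submodule ℂ (FreeProd X × FreeProd Y) :=
  Submodule.span ℂ ({q | ∃ b : B, q = ((b, 0), (b, 0))} ∪
    {q | ∃ P : List (RelElt R),
      q = (tensor X (P.map RelElt.left), tensor Y (P.map RelElt.right))})

variable {R}

theorem base_mem_freeRel (b : B) :
    (((b, 0), (b, 0)) : FreeProd X × FreeProd Y) ∈ freeRel R :=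
  Submodule.subset_span (Or.inl ⟨b, rfl⟩)

theorem tensor_mem_freeRel (P : List (RelElt R)) :
    (tensor X (P.map RelElt.left), tensor Y (P.map RelElt.right)) ∈ freeRel R :=
  Submodule.subset_span (Or.inr ⟨P, rfl⟩)

theorem tensor_fst {l : List (Elt X)} (h : l ≠ []) : (tensor X l).1 = 0 := by
  rw [tensor, dif_neg h]
  split <;> rfl

/-- Nonempty tensors have no B-component and the other generators are diagonal. This is what turns
membership in the relation into equality of moments. -/
theorem fst_eq_of_mem_freeRel {q : FreeProd X × FreeProd Y} (hq : q ∈ freeRel R) :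
    q.1.1 = q.2.1 := by
  induction hq using Submodule.span_induction with
  | mem q hq =>
    rcases hq with ⟨b, rfl⟩ | ⟨P, rfl⟩
    · rfl
    · by_cases h : P = []
      · subst h; simp [tensor_nil]
      · simp [tensor_fst, h]
  | zero => rfl
  | add p q _ _ hp hq => simp [hp, hq]
  | smul c q _ hq => simp [hq]

/-! ### Operators preserving the relation -/

/-- Pairs of linear maps given by their values on elementary tensors preserve relations as soon as
they do so on generators. -/
theorem liftFree_pair_mem {V W : Type*} [AddCommGroup V] [Module ℂ V] [AddCommGroup W] [Module ℂ W]
    (U : Submodule ℂ (V × W)) {g : B →ₗ[ℂ] V} {g' : B →ₗ[ℂ] W} {f : List (Elt X) → V}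
    {f' : List (Elt Y) → W} (hf : IsBalanced X f) (hf' : IsBalanced Y f')
    (hb : ∀ b, (g b, g' b) ∈ U)
    (ht : ∀ P : List (RelElt R), P ≠ [] → (f (P.map RelElt.left), f' (P.map RelElt.right)) ∈ U)
    {q : FreeProd X × FreeProd Y} (hq : q ∈ freeRel R) :
    (liftFree X g f hf q.1, liftFree Y g' f' hf' q.2) ∈ U := by
  -- The preimage of `U` under the product map is a submodule, so only generators have to be
  -- checked.
  suffices h : freeRel R ≤ U.comap ((liftFree X g f hf).prodMap (liftFree Y g' f' hf')) from h hq
  refine Submodule.span_le.2 ?_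
  rintro _ (⟨b, rfl⟩ | ⟨P, rfl⟩)
  · change (liftFree X g f hf (b, 0), liftFree Y g' f' hf' (b, 0)) ∈ U
    simpa only [liftFree_base] using hb b
  · change (liftFree X g f hf (tensor X (P.map RelElt.left)),
      liftFree Y g' f' hf' (tensor Y (P.map RelElt.right))) ∈ U
    by_cases h : P = []
    · subst h
      simpa only [List.map_nil, tensor_nil, liftFree_base] using hb 1
    -- Related lists have the same indices, so they alternate together; otherwise both tensors are
    -- 0.
    · by_cases ha : ((P.map RelElt.left).map Sigma.fst).IsChain (· ≠ ·)
      · rw [liftFree_tensor _ _ _ _ _ (by simpa using h) ha,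
          liftFree_tensor _ _ _ _ _ (by simpa using h) (RelElt.map_idx P ▸ ha)]
        exact ht P h
      · rw [tensor_of_not_alt _ _ ha, tensor_of_not_alt _ _ (RelElt.map_idx P ▸ ha), map_zero,
          map_zero]
        exact U.zero_mem

theorem lmulList_mem_freeRel (b : B) (P : List (RelElt R)) :
    (lmulList X b (P.map RelElt.left), lmulList Y b (P.map RelElt.right)) ∈ freeRel R := by
  rcases P with _ | ⟨⟨k, x, y, h⟩, P⟩
  · exact base_mem_freeRel b
  · exact tensor_mem_freeRel (⟨k, b • x, b • y, by simpa using (R k).L_mem b _ h⟩ :: P)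

theorem rmulList_mem_freeRel (b : B) (P : List (RelElt R)) :
    (rmulList X b (P.map RelElt.left), rmulList Y b (P.map RelElt.right)) ∈ freeRel R := by
  rcases List.eq_nil_or_concat P with rfl | ⟨P, ⟨k, x, y, h⟩, rfl⟩
  · exact base_mem_freeRel b
  · have := tensor_mem_freeRel
      (P ++ [(⟨k, op b • x, op b • y, by simpa using (R k).R_mem b _ h⟩ : RelElt R)])
    simpa [RelElt.left, RelElt.right, rmulList_snoc] using this

/-- Joining β ⊕ x to a tensor t gives βt + x ⊗ t. The scalars β coincide on both sides and the parts
x are related by `BimodRel.snd_mem`, so each summand gives a related pair. -/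
theorem joinLeft_mem_freeRel {k : K} {q : (X k).Total × (Y k).Total} (hq : q ∈ (R k).rel)
    (P : List (RelElt R)) :
    (joinLeft X k (P.map RelElt.left) q.1, joinLeft Y k (P.map RelElt.right) q.2)
      ∈ freeRel R := by
  have h := (freeRel R).add_mem (lmulList_mem_freeRel q.1.1 P)
    (tensor_mem_freeRel (⟨k, q.1.2, q.2.2, (R k).snd_mem hq⟩ :: P))
  rw [Prod.mk_add_mk] at h
  -- The second coordinate still carries the B-component of `q.1`; it is replaced by that of `q.2`.
  nth_rewrite 2 [(R k).fst_eq q hq] at h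
  exact h

theorem joinRight_mem_freeRel {k : K} {q : (X k).Total × (Y k).Total} (hq : q ∈ (R k).rel)
    (P : List (RelElt R)) :
    (joinRight X k (P.map RelElt.left) q.1, joinRight Y k (P.map RelElt.right) q.2)
      ∈ freeRel R := by
  have h := (freeRel R).add_mem (rmulList_mem_freeRel q.1.1 P)
    (tensor_mem_freeRel (P ++ [(⟨k, q.1.2, q.2.2, (R k).snd_mem hq⟩ : RelElt R)]))
  rw [Prod.mk_add_mk] at h
  nth_rewrite 2 [(R k).fst_eq q hq] at h
  simpa [joinRight, RelElt.left, RelElt.right] using h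

/-- Whether `a` is applied to the first factor or to the vacuum depends only on the first index,
which related tensors share. Either way it acts on a related pair, and the result is joined to
related remaining factors. -/
theorem lambda_mem_freeRel {k : K} {a : (X k).leftAlg} {a' : (Y k).leftAlg}
    (ha : ∀ q ∈ (R k).rel, (a.1 q.1, a'.1 q.2) ∈ (R k).rel)
    {q : FreeProd X × FreeProd Y} (hq : q ∈ freeRel R) :
    (lambda X k a q.1, lambda Y k a' q.2) ∈ freeRel R := by
  refine liftFree_pair_mem _ _ _ (fun b => ?_) (fun P hP => ?_) hq
  · exact joinLeft_mem_freeRel (ha _ ((R k).base_mem b)) []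
  · rcases P with _ | ⟨⟨j, x, y, h⟩, P⟩
    · exact absurd rfl hP
    · by_cases hj : j = k
      · subst hj
        simp only [List.map_cons, RelElt.left, RelElt.right, lambdaList_self]
        exact joinLeft_mem_freeRel (ha _ h) P
      · simp only [List.map_cons, RelElt.left, RelElt.right, lambdaList_ne _ _ _ _ _ _ hj]
        exact joinLeft_mem_freeRel (ha _ (R k).one_mem) (⟨j, x, y, h⟩ :: P)

theorem rho_mem_freeRel {k : K} {a : (X k).rightAlg} {a' : (Y k).rightAlg}
    (ha : ∀ q ∈ (R k).rel, (a.1 q.1, a'.1 q.2) ∈ (R k).rel)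
    {q : FreeProd X × FreeProd Y} (hq : q ∈ freeRel R) :
    (rho X k a q.1, rho Y k a' q.2) ∈ freeRel R := by
  refine liftFree_pair_mem _ _ _ (fun b => ?_) (fun P hP => ?_) hq
  · exact joinRight_mem_freeRel (ha _ ((R k).base_mem b)) []
  · rcases List.eq_nil_or_concat P with rfl | ⟨P, ⟨j, x, y, h⟩, rfl⟩
    · exact absurd rfl hP
    · have e1 : (P.concat ⟨j, x, y, h⟩).map RelElt.left = P.map RelElt.left ++ [⟨j, x⟩] := by
        simp [RelElt.left]
      have e2 : (P.concat ⟨j, x, y, h⟩).map RelElt.right = P.map RelElt.right ++ [⟨j, y⟩] := by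
        simp [RelElt.right]
      by_cases hj : j = k
      · subst hj
        rw [e1, e2, rhoList_self, rhoList_self]
        exact joinRight_mem_freeRel (ha _ h) P
      · rw [e1, e2, rhoList_ne _ _ _ _ _ _ hj, rhoList_ne _ _ _ _ _ _ hj, ← e1, ← e2]
        exact joinRight_mem_freeRel (ha _ (R k).one_mem) _

/-- Only B and the one-factor tensors of index `k` survive the projection; every other related pair
of tensors goes to (0, 0). -/
theorem proj_mem_rel (k : K) {q : FreeProd X × FreeProd Y} (hq : q ∈ freeRel R) :
    (proj X k q.1, proj Y k q.2) ∈ (R k).rel := by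
  refine liftFree_pair_mem _ _ _ (fun b => (R k).base_mem b) (fun P hP => ?_) hq
  rcases P with _ | ⟨⟨j, x, y, h⟩, _ | ⟨e, P⟩⟩
  · exact absurd rfl hP
  · by_cases hj : j = k
    · subst hj
      simpa [projList, RelElt.left, RelElt.right] using h
    · simp only [List.map_cons, List.map_nil, RelElt.left, RelElt.right, projList, dif_neg hj]
      exact (R k).rel.zero_mem
  · exact (R k).rel.zero_mem

/-- The operator passes through 𝒳_k alone, so `T` and `T'` need only preserve the relation there and
need not commute with right multiplications. -/
theorem boolAct_mem_freeRel {k : K} {T : (X k).Op} {T' : (Y k).Op}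
    (hT : ∀ q ∈ (R k).rel, (T q.1, T' q.2) ∈ (R k).rel)
    {q : FreeProd X × FreeProd Y} (hq : q ∈ freeRel R) :
    (boolAct X k T q.1, boolAct Y k T' q.2) ∈ freeRel R :=
  joinLeft_mem_freeRel (hT _ (proj_mem_rel k hq)) []

end Pairs

/-! ## The joint distribution on the reduced free product -/

section Reps

variable {B 𝒜 : Type u} [Ring B] [Algebra ℂ B] [Ring 𝒜] [Algebra ℂ 𝒜] {S : BBSpace B 𝒜}

/-- The relation between two representations of one triple with the same joint distribution:
it consists of the pairs `(T 1, T' 1)` for corresponding polynomials `T`, `T'` in the operators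
representing the letters. -/
def FaceRep.vacuumRel {A : FaceTriple S} {M N : Bimod B} (σ : FaceRep A M) (τ : FaceRep A N) :
    Submodule ℂ (M.Total × N.Total) :=
  Submodule.span ℂ (Set.range fun w : List (Letter A) =>
    ((w.map σ.act).prod (1, 0), (w.map τ.act).prod (1, 0)))

theorem FaceRep.act_mem_vacuumRel {A : FaceTriple S} {M N : Bimod B} (σ : FaceRep A M)
    (τ : FaceRep A N) (z : Letter A) {q : M.Total × N.Total} (hq : q ∈ σ.vacuumRel τ) :
    (σ.act z q.1, τ.act z q.2) ∈ σ.vacuumRel τ := by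
  suffices h : σ.vacuumRel τ ≤ (σ.vacuumRel τ).comap ((σ.act z).prodMap (τ.act z)) from h hq
  refine Submodule.span_le.2 ?_
  rintro _ ⟨w, rfl⟩
  exact Submodule.subset_span ⟨z :: w, by simp⟩

/-- The relation between two representations with the same joint distribution, as a relation of
bimodules with specified projection. -/
def FaceRep.bimodRel {A : FaceTriple S} {M N : Bimod B} (σ : FaceRep A M) (τ : FaceRep A N)
    (h : σ.dist = τ.dist) : BimodRel M N where
  rel := σ.vacuumRel τ
  one_mem := Submodule.subset_span ⟨[], by simp⟩
  L_mem b q hq := by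
    -- L_b is itself a letter of the left face, and both representations carry it to left
    -- multiplication by b.
    have := σ.act_mem_vacuumRel τ (.left ⟨S.L b, A.L_mem b⟩) hq
    simp only [FaceRep.act, σ.ℓ_L, τ.ℓ_L] at this
    exact this
  R_mem b q hq := by
    have := σ.act_mem_vacuumRel τ (.right ⟨S.R b, A.R_mem b⟩) hq
    simp only [FaceRep.act, σ.r_R, τ.r_R] at this
    exact this
  fst_eq q hq := by
    induction hq using Submodule.span_induction with
    | mem q hq =>
      obtain ⟨w, rfl⟩ := hq
      -- On the spanning pairs the claim is the equality of the moments of `w`.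
      exact congrFun h w
    | zero => rfl
    | add p q _ _ hp hq => simp [hp, hq]
    | smul c q _ hq => simp [hq]

theorem freeAct_mem_freeRel {K : Type v} {Γ : K → FaceTriple S} {X Y : K → Bimod B}
    {R : ∀ k, BimodRel (X k) (Y k)} (σ : ∀ k, FaceRep (Γ k) (X k)) (τ : ∀ k, FaceRep (Γ k) (Y k))
    (k : K) (z : Letter (Γ k))
    (hz : ∀ q ∈ (R k).rel, ((σ k).act z q.1, (τ k).act z q.2) ∈ (R k).rel)
    {q : FreeProd X × FreeProd Y} (hq : q ∈ freeRel R) :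
    (freeAct σ ⟨k, z⟩ q.1, freeAct τ ⟨k, z⟩ q.2) ∈ freeRel R := by
  cases z with
  | left z =>
    simp only [freeAct]
    exact lambda_mem_freeRel hz hq
  | right z =>
    simp only [freeAct]
    exact rho_mem_freeRel hz hq
  | bool z =>
    simp only [freeAct]
    exact boolAct_mem_freeRel hz hq

/-- The joint distribution of the represented family on the reduced free product depends only on
the joint distributions of the single represented triples. -/
theorem freeDist_congr {K : Type v} {Γ : K → FaceTriple S} {X Y : K → Bimod B}
    (σ : ∀ k, FaceRep (Γ k) (X k)) (τ : ∀ k, FaceRep (Γ k) (Y k))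
    (h : ∀ k, (σ k).dist = (τ k).dist) : freeDist σ = freeDist τ := by
  have key : ∀ w : List (Σ k, Letter (Γ k)),
      ((w.map (freeAct σ)).prod (1, 0), (w.map (freeAct τ)).prod (1, 0))
        ∈ freeRel fun k => (σ k).bimodRel (τ k) (h k) := by
    intro w
    induction w with
    | nil => exact base_mem_freeRel 1
    | cons Z w ih =>
      simp only [List.map_cons, List.prod_cons, Module.End.mul_apply]
      exact freeAct_mem_freeRel σ τ Z.1 Z.2
        (fun q hq => (σ Z.1).act_mem_vacuumRel (τ Z.1) Z.2 hq) ih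
  exact funext fun w => fst_eq_of_mem_freeRel (key w)

/-! ### Restriction to a single triple -/

theorem rho_incl {K : Type v} (X : K → Bimod B) (k : K) (a : (X k).rightAlg) (ξ : (X k).Total) :
    rho X k a (incl X k ξ) = incl X k (a.1 ξ) := by
  have h1 : rho X k a (tensor X [⟨k, ξ.2⟩]) = incl X k (a.1 (0, ξ.2)) := by
    rw [rho, liftFree_tensor _ _ _ _ _ (by simp) (by simp)]
    exact rhoList_self X k a.1 ξ.2 []
  have h2 : rho X k a (ξ.1, 0) = incl X k (a.1 (ξ.1, 0)) := by
    rw [rho, liftFree_base]; rfl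
  change rho X k a (lmulList X ξ.1 [] + tensor X [⟨k, ξ.2⟩]) = _
  rw [map_add, h1, lmulList, h2, ← map_add, ← map_add]
  simp

/-- The copy of 𝒳_k is invariant under the letters of index `k`, which act on it as in the given
representation; hence moments in one index can be computed in 𝒳_k. -/
theorem freeAct_incl {K : Type v} {Γ : K → FaceTriple S} {X : K → Bimod B}
    (σ : ∀ k, FaceRep (Γ k) (X k)) (k : K) (z : Letter (Γ k)) (ξ : (X k).Total) :
    freeAct σ ⟨k, z⟩ (incl X k ξ) = incl X k ((σ k).act z ξ) := by
  cases z with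
  | left z => exact lambda_incl X k _ ξ
  | right z => exact rho_incl X k _ ξ
  | bool z => simp [freeAct, boolAct, proj_incl, FaceRep.act]

theorem incl_one {K : Type v} (X : K → Bimod B) (k : K) : incl X k (1, 0) = (1, 0) := by
  have h : tensor X [⟨k, 0⟩] = 0 := by
    simpa using (isBalanced_tensor X).smul [] [] k 0 0
  change lmulList X 1 [] + tensor X [⟨k, 0⟩] = _
  rw [h, add_zero, lmulList]

theorem incl_fst {K : Type v} (X : K → Bimod B) (k : K) (ξ : (X k).Total) :
    (incl X k ξ).1 = ξ.1 := by
  change (lmulList X ξ.1 [] + tensor X [⟨k, ξ.2⟩]).1 = _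
  rw [Prod.fst_add, tensor_fst (by simp), add_zero, lmulList]

/-- On words in the letters of a single triple, the joint distribution of the represented family
is the one of the representation of that triple. -/
theorem freeDist_single {K : Type v} {Γ : K → FaceTriple S} {X : K → Bimod B}
    (σ : ∀ k, FaceRep (Γ k) (X k)) (k : K) (w : List (Letter (Γ k))) :
    freeDist σ (w.map (Sigma.mk k)) = (σ k).dist w := by
  have key : ∀ ξ : (X k).Total, ((w.map (Sigma.mk k)).map (freeAct σ)).prod (incl X k ξ)
      = incl X k ((w.map (σ k).act).prod ξ) := by
    intro ξ
    induction w with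
    | nil => simp
    | cons z w ih =>
      simp only [List.map_cons, List.prod_cons, Module.End.mul_apply, ih, freeAct_incl]
  rw [freeDist, vacuumExp, ← incl_one X k, key, incl_fst, FaceRep.dist, vacuumExp]

/-- Independence is evaluated on words whose letters all have index `k`. This makes the unknown
representations in the definition of independence comparable with any prescribed ones. -/
theorem IsFFBVia.dist_eq {K : Type v} {Γ : K → FaceTriple S} {X : K → Bimod B}
    {σ : ∀ k, FaceRep (Γ k) (X k)} (h : IsFFBVia Γ σ) (k : K) : (Γ k).dist = (σ k).dist := by
  funext w
  rw [← freeDist_single σ k w, ← h, FaceTriple.dist, jointDist, List.map_map]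
  rfl

/-- A family which is independent via some representations is so via all representations with
the right single distributions. -/
theorem IsFFB.via {K : Type v} {Γ : K → FaceTriple S} (h : IsFFB Γ) {X : K → Bimod B}
    (σ : ∀ k, FaceRep (Γ k) (X k)) (hσ : ∀ k, (Γ k).dist = (σ k).dist) : IsFFBVia Γ σ := by
  obtain ⟨Y, τ, hτ⟩ := h
  exact Eq.trans hτ (freeDist_congr τ σ fun k => (hτ.dist_eq k).symm.trans (hσ k))

end Reps


/-! ## The standard representation of a triple of faces -/

section Standard

variable {B 𝒜 : Type u} [Ring B] [Algebra ℂ B] [Ring 𝒜] [Algebra ℂ 𝒜] (S : BBSpace B 𝒜)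

/-! ### Rules for the two copies of B in 𝒜 -/

theorem BBSpace.L_one : S.L 1 = 1 := map_one S.ε

theorem BBSpace.L_mul (b c : B) : S.L (b * c) = S.L b * S.L c := by
  simp [BBSpace.L, ← map_mul]

theorem BBSpace.R_mul (b c : B) : S.R (b * c) = S.R c * S.R b := by
  simp [BBSpace.R, ← map_mul]

theorem BBSpace.commute_L_R (b c : B) : Commute (S.L b) (S.R c) := by
  simp [commute_iff_eq, BBSpace.L, BBSpace.R, ← map_mul]

theorem BBSpace.L_add (b c : B) : S.L (b + c) = S.L b + S.L c := by
  simp [BBSpace.L, TensorProduct.add_tmul]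

theorem BBSpace.L_smul (z : ℂ) (b : B) : S.L (z • b) = z • S.L b := by
  simp only [BBSpace.L, ← TensorProduct.smul_tmul', map_smul]

theorem BBSpace.R_one : S.R 1 = 1 := map_one S.ε

theorem BBSpace.R_add (b c : B) : S.R (b + c) = S.R b + S.R c := by
  simp [BBSpace.R, TensorProduct.tmul_add]

theorem BBSpace.R_smul (z : ℂ) (b : B) : S.R (z • b) = z • S.R b := by
  simp [BBSpace.R]

theorem BBSpace.E_L_mul (b : B) (T : 𝒜) : S.E (S.L b * T) = b * S.E T := by
  simpa [BBSpace.L] using S.E_bimodule b 1 T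

theorem BBSpace.E_R_mul (b : B) (T : 𝒜) : S.E (S.R b * T) = S.E T * b := by
  simpa [BBSpace.R] using S.E_bimodule 1 b T

theorem BBSpace.E_mul_L (b : B) (T : 𝒜) : S.E (T * S.L b) = S.E (T * S.R b) :=
  S.E_balanced b T

/-- The linear maps `𝒜 → B` which respect the actions of `B` on both sides. -/
def BBSpace.dual : Submodule ℂ (𝒜 →ₗ[ℂ] B) where
  carrier := {f | ∀ b T, f (S.L b * T) = b * f T ∧ f (S.R b * T) = f T * b}
  add_mem' hf hg b T := by simp [(hf b T).1, (hg b T).1, (hf b T).2, (hg b T).2, mul_add, add_mul]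
  zero_mem' b T := by simp
  smul_mem' c f hf b T := by simp [(hf b T).1, (hf b T).2]

/-- The action `(a f)(T) = f (T a)` of `𝒜`. -/
def BBSpace.dualAct : 𝒜 →ₐ[ℂ] Module.End ℂ S.dual :=
  AlgHom.ofLinearMap
    { toFun a :=
        { toFun f := ⟨f.1 ∘ₗ LinearMap.mulRight ℂ a, fun b T => by
            simp [mul_assoc, f.2 b (T * a)]⟩
          map_add' f g := rfl
          map_smul' c f := rfl }
      map_add' a b := by ext f T; simp [mul_add]
      map_smul' c a := by ext f T; simp }
    (by ext f T; simp)
    (fun a b => by ext f T; simp [mul_assoc])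

theorem BBSpace.dualAct_apply (a : 𝒜) (f : S.dual) (T : 𝒜) :
    (S.dualAct a f).1 T = f.1 (T * a) := rfl

/-- Evaluation at `1`. -/
def BBSpace.dualEval : S.dual →ₗ[ℂ] B := LinearMap.applyₗ (1 : 𝒜) ∘ₗ S.dual.subtype

theorem BBSpace.dualEval_apply (f : S.dual) : S.dualEval f = f.1 1 := rfl

/-- With `dualEval_R`, this makes evaluation at 1 a bimodule map, so that its kernel is a
sub-bimodule and can serve as the complement of B. -/
theorem BBSpace.dualEval_L (b : B) (f : S.dual) : S.dualEval (S.dualAct (S.L b) f) =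
    b * S.dualEval f := by
  simpa [BBSpace.dualEval_apply, BBSpace.dualAct_apply] using (f.2 b 1).1

theorem BBSpace.dualEval_R (b : B) (f : S.dual) : S.dualEval (S.dualAct (S.R b) f) =
    S.dualEval f * b := by
  simpa [BBSpace.dualEval_apply, BBSpace.dualAct_apply] using (f.2 b 1).2

/-- The copy of `B` in the dual: `b` is the functional `T ↦ E (T L_b)`. -/
def BBSpace.dualBase : B →ₗ[ℂ] S.dual where
  toFun b := ⟨S.E ∘ₗ LinearMap.mulRight ℂ (S.L b), fun c T => by
    simp [mul_assoc, S.E_L_mul, S.E_R_mul]⟩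
  map_add' b c := by ext T; simp [S.L_add, mul_add]
  map_smul' z b := by ext T; simp [S.L_smul]

theorem BBSpace.dualBase_apply (b : B) (T : 𝒜) : (S.dualBase b).1 T = S.E (T * S.L b) := rfl

/-- Here the normalization E 1 = 1 enters: it makes evaluation at 1 a left inverse of the embedding
of B, so that B splits off. -/
theorem BBSpace.dualEval_base (h1 : S.E 1 = 1) (b : B) : S.dualEval (S.dualBase b) = b := by
  rw [BBSpace.dualEval_apply, BBSpace.dualBase_apply, one_mul, ← mul_one (S.L b), S.E_L_mul, h1,
    mul_one]

theorem BBSpace.dualBase_L (b c : B) :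
    S.dualBase (b * c) = S.dualAct (S.L b) (S.dualBase c) := by
  ext T
  simp [BBSpace.dualAct_apply, BBSpace.dualBase_apply, S.L_mul, mul_assoc]

/-- The embedding is defined through L, so compatibility with the right action rests on the axiom
E(T L_b) = E(T R_b), used once in each direction. -/
theorem BBSpace.dualBase_R (b c : B) :
    S.dualBase (c * b) = S.dualAct (S.R b) (S.dualBase c) := by
  ext T
  simp only [BBSpace.dualAct_apply, BBSpace.dualBase_apply]
  rw [S.E_mul_L, S.E_mul_L, S.R_mul, mul_assoc]

/-! ### The complement of B as a bimodule -/

/-- The complement of `B` in the dual: the functionals which vanish at `1`. -/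
abbrev BBSpace.dualCompl : Submodule ℂ S.dual := LinearMap.ker S.dualEval

instance : AddCommGroup S.dualCompl := @Submodule.addCommGroup ℂ S.dual _ _ _ _

instance : SMul B S.dualCompl where
  smul b f := ⟨S.dualAct (S.L b) f.1, by
    rw [LinearMap.mem_ker, S.dualEval_L, LinearMap.mem_ker.1 f.2, mul_zero]⟩

instance : SMul Bᵐᵒᵖ S.dualCompl where
  smul b f := ⟨S.dualAct (S.R b.unop) f.1, by
    rw [LinearMap.mem_ker, S.dualEval_R, LinearMap.mem_ker.1 f.2, zero_mul]⟩

theorem BBSpace.coe_smul_dualCompl (b : B) (f : S.dualCompl) :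
    ((b • f : S.dualCompl) : S.dual) = S.dualAct (S.L b) f := rfl

theorem BBSpace.coe_op_smul_dualCompl (b : Bᵐᵒᵖ) (f : S.dualCompl) :
    ((b • f : S.dualCompl) : S.dual) = S.dualAct (S.R b.unop) f := rfl

theorem BBSpace.L_zero : S.L 0 = 0 := by simp [BBSpace.L]

theorem BBSpace.R_zero : S.R 0 = 0 := by simp [BBSpace.R]

instance : Module B S.dualCompl where
  one_smul f := Subtype.ext (by simp [S.coe_smul_dualCompl, S.L_one])
  mul_smul b c f := Subtype.ext (by simp [S.coe_smul_dualCompl, S.L_mul])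
  smul_zero b := Subtype.ext (by simp [S.coe_smul_dualCompl])
  smul_add b f g := Subtype.ext (by simp [S.coe_smul_dualCompl])
  add_smul b c f := Subtype.ext (by simp [S.coe_smul_dualCompl, S.L_add])
  zero_smul f := Subtype.ext (by simp [S.coe_smul_dualCompl, S.L_zero])

instance : Module Bᵐᵒᵖ S.dualCompl where
  one_smul f := Subtype.ext (by simp [S.coe_op_smul_dualCompl, S.R_one])
  mul_smul b c f := Subtype.ext (by simp [S.coe_op_smul_dualCompl, S.R_mul])
  smul_zero b := Subtype.ext (by simp [S.coe_op_smul_dualCompl])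
  smul_add b f g := Subtype.ext (by simp [S.coe_op_smul_dualCompl])
  add_smul b c f := Subtype.ext (by simp [S.coe_op_smul_dualCompl, S.R_add])
  zero_smul f := Subtype.ext (by simp [S.coe_op_smul_dualCompl, S.R_zero])

/-- The complement of `B` in the dual, as a bimodule. -/
def BBSpace.dualBimod : Bimod B :=
  { carrier := S.dualCompl
    commActions := ⟨fun b c f => Subtype.ext (by
      simp only [S.coe_smul_dualCompl, S.coe_op_smul_dualCompl]
      rw [← Module.End.mul_apply, ← map_mul, (S.commute_L_R b c.unop).eq, map_mul]; rfl)⟩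
    towerLeft := ⟨fun z b f => Subtype.ext (by
      simp [S.coe_smul_dualCompl, S.L_smul])⟩
    towerRight := ⟨fun z b f => Subtype.ext (by
      simp [S.coe_op_smul_dualCompl, S.R_smul])⟩ }

/-- The complement as a subspace of the dual. -/
def BBSpace.dualIncl : S.dualBimod.carrier →ₗ[ℂ] S.dual := S.dualCompl.subtype

theorem BBSpace.dualEval_incl (f : S.dualBimod.carrier) : S.dualEval (S.dualIncl f) = 0 :=
  LinearMap.mem_ker.1 f.2

theorem BBSpace.dualIncl_injective : Function.Injective S.dualIncl := Subtype.val_injective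

/-- The decomposition of the dual as the direct sum of `B` and its complement. -/
def BBSpace.dualEquiv (h1 : S.E 1 = 1) : S.dualBimod.Total ≃ₗ[ℂ] S.dual :=
  LinearEquiv.ofBijective (S.dualBase.coprod S.dualIncl) (by
    constructor
    · rintro ⟨b, f⟩ ⟨c, g⟩ h
      simp only [LinearMap.coprod_apply] at h
      -- Evaluation at 1 kills the complement and recovers the B-component.
      obtain rfl : b = c := by
        simpa [S.dualEval_base h1, S.dualEval_incl] using congrArg S.dualEval h
      rw [S.dualIncl_injective (add_left_cancel h)]
    · intro f
      -- The B-component has to be f(1); what remains of f vanishes at 1.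
      refine ⟨(S.dualEval f, ⟨f - S.dualBase (S.dualEval f), ?_⟩), ?_⟩
      · change S.dualEval f - S.dualEval (S.dualBase (S.dualEval f)) = 0
        rw [S.dualEval_base h1, sub_self]
      · rw [LinearMap.coprod_apply]
        exact add_sub_cancel (S.dualBase (S.dualEval f)) f)

theorem BBSpace.dualEquiv_apply (h1 : S.E 1 = 1) (ξ : S.dualBimod.Total) :
    S.dualEquiv h1 ξ = S.dualBase ξ.1 + S.dualIncl ξ.2 := rfl

theorem BBSpace.dualEval_equiv (h1 : S.E 1 = 1) (ξ : S.dualBimod.Total) :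
    S.dualEval (S.dualEquiv h1 ξ) = ξ.1 := by
  rw [S.dualEquiv_apply, map_add, S.dualEval_base h1, S.dualEval_incl, add_zero]

/-- The representation of `𝒜` on the bimodule with specified projection. -/
def BBSpace.stdRep (h1 : S.E 1 = 1) : 𝒜 →ₐ[ℂ] S.dualBimod.Op :=
  ((S.dualEquiv h1).symm.conjAlgEquiv ℂ).toAlgHom.comp S.dualAct

theorem BBSpace.dualEquiv_stdRep (h1 : S.E 1 = 1) (a : 𝒜) (ξ : S.dualBimod.Total) :
    S.dualEquiv h1 (S.stdRep h1 a ξ) = S.dualAct a (S.dualEquiv h1 ξ) := by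
  simp [BBSpace.stdRep, LinearEquiv.conjAlgEquiv_apply]

theorem BBSpace.stdRep_L (h1 : S.E 1 = 1) (b : B) : S.stdRep h1 (S.L b) = S.dualBimod.L b := by
  refine LinearMap.ext fun ξ => (S.dualEquiv h1).injective ?_
  rw [S.dualEquiv_stdRep, S.dualEquiv_apply, S.dualEquiv_apply, map_add, ← S.dualBase_L]
  rfl

theorem BBSpace.stdRep_R (h1 : S.E 1 = 1) (b : B) : S.stdRep h1 (S.R b) = S.dualBimod.R b := by
  refine LinearMap.ext fun ξ => (S.dualEquiv h1).injective ?_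
  rw [S.dualEquiv_stdRep, S.dualEquiv_apply, S.dualEquiv_apply, map_add, ← S.dualBase_R]
  rfl

/-- The vacuum corresponds to the functional E, which `a` carries to T ↦ E(T a); evaluation at 1
returns E(a). -/
theorem BBSpace.vacuumExp_stdRep (h1 : S.E 1 = 1) (a : 𝒜) :
    vacuumExp (S.stdRep h1 a) = S.E a := by
  rw [vacuumExp, ← S.dualEval_equiv h1, S.dualEquiv_stdRep, S.dualEquiv_apply]
  simp [BBSpace.dualEval_apply, BBSpace.dualAct_apply, BBSpace.dualBase_apply, S.L_one]

variable {S}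

/-- Every triple of faces in a space with `E 1 = 1` has a representation with the same joint
distribution. -/
def FaceTriple.stdRep (A : FaceTriple S) (h1 : S.E 1 = 1) : FaceRep A S.dualBimod where
  ℓ := ((S.stdRep h1).comp A.left.val).codRestrict _ fun a => by
    rw [Bimod.leftAlg, Subalgebra.mem_centralizer_iff]
    rintro _ ⟨b, rfl⟩
    -- Commutation with R_b already holds in 𝒜, and `stdRep` carries R_b to right multiplication.
    have := (Subalgebra.mem_centralizer_iff ℂ).1 (A.left_le a.2) _ ⟨b, rfl⟩
    rw [← S.stdRep_R h1, AlgHom.comp_apply, ← map_mul, ← map_mul]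
    exact congrArg (S.stdRep h1) this
  r := ((S.stdRep h1).comp A.right.val).codRestrict _ fun a => by
    rw [Bimod.rightAlg, Subalgebra.mem_centralizer_iff]
    rintro _ ⟨b, rfl⟩
    have := (Subalgebra.mem_centralizer_iff ℂ).1 (A.right_le a.2) _ ⟨b, rfl⟩
    rw [← S.stdRep_L h1, AlgHom.comp_apply, ← map_mul, ← map_mul]
    exact congrArg (S.stdRep h1) this
  m := (S.stdRep h1 : 𝒜 →ₙₐ[ℂ] S.dualBimod.Op).comp (NonUnitalSubalgebraClass.subtype A.bool)
  ℓ_L b := S.stdRep_L h1 b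
  r_R b := S.stdRep_R h1 b

theorem FaceTriple.stdRep_dist (A : FaceTriple S) (h1 : S.E 1 = 1) :
    A.dist = (A.stdRep h1).dist := by
  funext w
  have h : (A.stdRep h1).act = fun z => S.stdRep h1 z.val := by
    funext z
    cases z <;> rfl
  rw [FaceRep.dist, h, FaceTriple.dist, ← S.vacuumExp_stdRep h1, map_list_prod, List.map_map]
  rfl

end Standard

/-! ## Images of triples of faces -/

section Images

variable {B 𝒜 𝒜' : Type u} [Ring B] [Algebra ℂ B] [Ring 𝒜] [Algebra ℂ 𝒜] [Ring 𝒜'] [Algebra ℂ 𝒜']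
  {S : BBSpace B 𝒜} {S' : BBSpace B 𝒜'}

/-- A representation of the image of a triple is a representation of the triple. -/
def FaceRep.pullback {A : FaceTriple S} {A' : FaceTriple S'} {M : Bimod B} (σ : FaceRep A' M)
    (φ : FaceImage A A') : FaceRep A M where
  ℓ := σ.ℓ.comp φ.left
  r := σ.r.comp φ.right
  m := σ.m.comp φ.bool
  ℓ_L b := by
    rw [← σ.ℓ_L b]
    exact congrArg (fun a => (σ.ℓ a : M.Op)) (Subtype.ext (φ.left_L b))
  r_R b := by
    rw [← σ.r_R b]
    exact congrArg (fun a => (σ.r a : M.Op)) (Subtype.ext (φ.right_R b))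

theorem FaceRep.pullback_dist {A : FaceTriple S} {A' : FaceTriple S'} {M : Bimod B}
    (σ : FaceRep A' M) (φ : FaceImage A A') (w : List (Letter A)) :
    (σ.pullback φ).dist w = σ.dist (w.map φ.map) := by
  have h : (σ.pullback φ).act = σ.act ∘ φ.map := by
    funext z
    cases z <;> rfl
  rw [FaceRep.dist, FaceRep.dist, h, List.map_map]

variable {K : Type v} {Γ : K → FaceTriple S} {Γ' : K → FaceTriple S'}

/-- A letter and its image act by the very same operator on the free product. -/
theorem freeDist_pullback {X : K → Bimod B} (σ : ∀ k, FaceRep (Γ' k) (X k))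
    (φ : ∀ k, FaceImage (Γ k) (Γ' k)) (w : List (Σ k, Letter (Γ k))) :
    freeDist (fun k => (σ k).pullback (φ k)) w
      = freeDist σ (w.map fun Z => ⟨Z.1, (φ Z.1).map Z.2⟩) := by
  have h : freeAct (fun k => (σ k).pullback (φ k))
      = freeAct σ ∘ fun Z => ⟨Z.1, (φ Z.1).map Z.2⟩ := by
    funext ⟨k, z⟩
    cases z <;> rfl
  rw [freeDist, freeDist, h, List.map_map]

theorem FaceImage.map_surjective {A : FaceTriple S} {A' : FaceTriple S'} (φ : FaceImage A A') :
    Function.Surjective φ.map := by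
  rintro (z | z | z)
  · obtain ⟨y, rfl⟩ := φ.left_surjective z; exact ⟨.left y, rfl⟩
  · obtain ⟨y, rfl⟩ := φ.right_surjective z; exact ⟨.right y, rfl⟩
  · obtain ⟨y, rfl⟩ := φ.bool_surjective z; exact ⟨.bool y, rfl⟩

/-- The empty word has moment E 1 in 𝒜 and 1 on the free product. The axioms of `BBSpace` do not
include this normalization. -/
theorem IsFFB.E_one {K : Type v} {Γ : K → FaceTriple S} (h : IsFFB Γ) : S.E 1 = 1 := by
  obtain ⟨X, σ, hσ⟩ := h
  simpa [jointDist, freeDist, vacuumExp] using congrFun hσ []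

/-- Independent families with the same single distributions have the same joint distribution. -/
theorem IsFFB.jointDist_eq (h : IsFFB Γ) (h' : IsFFB Γ') (φ : ∀ k, FaceImage (Γ k) (Γ' k))
    (hd : ∀ k, (Γ k).dist = fun w => (Γ' k).dist (w.map (φ k).map)) :
    jointDist Γ = fun w => jointDist Γ' (w.map fun Z => ⟨Z.1, (φ Z.1).map Z.2⟩) := by
  obtain ⟨X, σ, hσ⟩ := h'
  -- The pulled back representations of Γ' have the single distributions of Γ, so Γ is independent
  -- via them as well.
  have hv := h.via (fun k => (σ k).pullback (φ k)) fun k => by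
    rw [hd k, hσ.dist_eq k]
    exact funext fun w => ((σ k).pullback_dist (φ k) w).symm
  funext w
  rw [congrFun hv w, freeDist_pullback, congrFun hσ]

/-- Independence is preserved under passing between families with the same joint distribution. -/
theorem isFFB_iff_of_jointDist_eq (φ : ∀ k, FaceImage (Γ k) (Γ' k))
    (hd : ∀ k, (Γ k).dist = fun w => (Γ' k).dist (w.map (φ k).map))
    (hj : jointDist Γ = fun w => jointDist Γ' (w.map fun Z => ⟨Z.1, (φ Z.1).map Z.2⟩)) :
    IsFFB Γ ↔ IsFFB Γ' := by
  constructor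
  · intro h
    have h1 : S'.E 1 = 1 := by
      rw [← h.E_one]
      simpa [jointDist] using (congrFun hj []).symm
    -- The representations witnessing independence of Γ may not factor through `φ`, so Γ' is
    -- represented afresh.
    let σ : ∀ k, FaceRep (Γ' k) S'.dualBimod := fun k => (Γ' k).stdRep h1
    have hv := h.via (fun k => (σ k).pullback (φ k)) fun k => by
      rw [hd k, (Γ' k).stdRep_dist h1]
      exact funext fun w => ((σ k).pullback_dist (φ k) w).symm
    refine ⟨_, σ, funext fun w => ?_⟩
    -- Every word in the letters of Γ' is the image of a word of Γ, so it suffices to compare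
    -- moments on images.
    have hs : Function.Surjective
        fun Z : Σ k, Letter (Γ k) => (⟨Z.1, (φ Z.1).map Z.2⟩ : Σ k, Letter (Γ' k)) := by
      rintro ⟨k, z⟩
      obtain ⟨y, rfl⟩ := (φ k).map_surjective z
      exact ⟨⟨k, y⟩, rfl⟩
    obtain ⟨w, rfl⟩ := List.map_surjective_iff.2 hs w
    rw [← freeDist_pullback, ← congrFun hv w, hj]
  · rintro ⟨X, σ, hσ⟩
    refine ⟨X, fun k => (σ k).pullback (φ k), funext fun w => ?_⟩
    rw [hj, freeDist_pullback, ← congrFun hσ]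

end Images

end FFB

end

theorem mainTheorem5 {B 𝒜 : Type u} [Ring B] [Algebra ℂ B] [Ring 𝒜] [Algebra ℂ 𝒜]
    (S : BBSpace B 𝒜) {K : Type v} (Γ : K → FaceTriple S)
    (X' : K → Bimod B) (ρ' : ∀ k, FaceRep (Γ k) (X' k))
    (hdist : ∀ k, (Γ k).dist = (ρ' k).dist) :
    (IsFFB Γ ↔ IsFFBVia Γ ρ') ∧
    (IsFFB Γ → jointDist Γ = freeDist ρ') ∧
    (∀ (𝒜' : Type u) [Ring 𝒜'] [Algebra ℂ 𝒜'] (S' : BBSpace B 𝒜') (Γ' : K → FaceTriple S')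
      (φ : ∀ k, FaceImage (Γ k) (Γ' k)),
      (∀ k, (Γ k).dist = fun w => (Γ' k).dist (w.map (φ k).map)) →
      (IsFFB Γ → IsFFB Γ' →
        jointDist Γ = fun w => jointDist Γ' (w.map fun Z => ⟨Z.1, (φ Z.1).map Z.2⟩)) ∧
      (jointDist Γ = (fun w => jointDist Γ' (w.map fun Z => ⟨Z.1, (φ Z.1).map Z.2⟩)) →
        (IsFFB Γ ↔ IsFFB Γ'))) :=
  ⟨⟨fun h => h.via ρ' hdist, fun h => ⟨X', ρ', h⟩⟩, fun h => h.via ρ' hdist,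
    fun _ _ _ _ _ φ hd => ⟨fun h h' => h.jointDist_eq h' φ hd, isFFB_iff_of_jointDist_eq φ hd⟩⟩
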